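/- Let $\alpha\in(0,1)\cup(1,2]$, $0<q<1$ and $F_{(\alpha)}>0$. For $F>0$ let $S(\alpha,1,F)$ denote the maximally skewed $\alpha$-stable law with location zero and scale parameter $F$, i.e. the law with characteristic function $$t\mapsto \exp\left(-F|t|^{\alpha}\left(1-\sqrt{-1}\,\mathrm{sign}(t)\tan\frac{\pi\alpha}{2}\right)\right).$$ Let $f_Z(\cdot;\alpha,1)$ and $F_Z(\cdot;\alpha,1)$ be the density (the derivative of the distribution function) and the distribution function of $Z=|X|$ with $X\sim S(\alpha,1,1)$, and let $$W_q=F_Z^{-1}(q;\alpha,1)=\inf\{t: F_Z(t;\alpha,1)\ge q\}.$$ Given $k$ i.i.d. samples $x_1,\dots,x_k\sim S(\alpha,1,F_{(\alpha)})$, consider the estimator $$\hat F_{(\alpha),q}=\left(\frac{q\text{-Quantile}\{|x_j|,\ j=1,\dots,k\}}{W_q}\right)^{\alpha},$$ where the sample $q$-quantile is the $q$-quantile of the empirical distribution of $|x_1|,\dots,|x_k|$, i.e. the smallest $t$ such that at least $qk$ of the $|x_j|$ are $\le t$. Then $Z$ is absolutely continuous with density $f_Z(\cdot;\alpha,1)$,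 $F_Z(\cdot;\alpha,1)$ is differentiable at $W_q$, $W_q>0$ and $f_Z(W_q;\alpha,1)>0$; the estimator $\hat F_{(\alpha),q}$ has finite variance for all sufficiently large $k$; and, as $k\to\infty$ with $\alpha$, $q$, $F_{(\alpha)}$ fixed, $$\mathrm{Var}\left(\hat F_{(\alpha),q}\right)=\frac1k\,\frac{(q-q^2)\,\alpha^2}{f_Z^2\left(F_Z^{-1}(q;\alpha,1);\alpha,1\right)\left(F_Z^{-1}(q;\alpha,1)\right)^2}\,F_{(\alpha)}^2+O\left(\frac1{k^2}\right).$$ -/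

import Mathlib

open MeasureTheory ProbabilityTheory

/-- `IsStableLaw α β F μ`: the probability measure `μ` on `ℝ` is the `β`-skewed `α`-stable law
`S(α, β, F)` with location zero and scale parameter `F`, for `0 < α ≤ 2`, `α ≠ 1`, that is, its
characteristic function is `exp (-F |t|^α (1 - i β sign(t) tan (π α / 2)))`. -/
structure IsStableLaw (α β F : ℝ) (μ : Measure ℝ) : Prop where
  isProbabilityMeasure : IsProbabilityMeasure μ
  charFun_eq : ∀ t : ℝ, charFun μ t =
    Complex.exp (-((F * |t| ^ α : ℝ) : ℂ) *
      (1 - Complex.I * ((β * Real.sign t * Real.tan (Real.pi * α / 2) : ℝ) : ℂ)))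

/-- The law of `|X|` when `X` has law `μ`. -/
noncomputable def absLaw (μ : Measure ℝ) : Measure ℝ := μ.map (fun x => |x|)

/-- The `q`-quantile `inf {t | q ≤ F(t)}` of a probability measure with distribution function `F`
(the inverse distribution function at `q`). -/
noncomputable def lawQuantile (μ : Measure ℝ) (q : ℝ) : ℝ := sInf {t : ℝ | q ≤ cdf μ t}

/-- The density of a law on `ℝ`, as the derivative of its distribution function. -/
noncomputable def lawDensity (μ : Measure ℝ) (z : ℝ) : ℝ := deriv (fun t => cdf μ t) z

/-- The sample `q`-quantile of `y₁, …, y_k`: the `q`-quantile of the empirical distribution, i.e.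
the least `t` such that at least a proportion `q` of the sample is `≤ t`. For `0 < q ≤ 1 ≤ k` it is
the `⌈qk⌉`-th smallest observation. -/
noncomputable def sampleQuantile (q : ℝ) {k : ℕ} (y : Fin k → ℝ) : ℝ :=
  sInf {t : ℝ | q * (k : ℝ) ≤ (((Finset.univ.filter fun j => y j ≤ t).card : ℕ) : ℝ)}

/-- The quantile estimator of the scale parameter from observations `x₁, …, x_k`:
`(sample q-quantile of |x_j| / W) ^ α`. -/
noncomputable def quantileEstimator (α q W : ℝ) {k : ℕ} (x : Fin k → ℝ) : ℝ :=
  (sampleQuantile q (fun j => |x j|) / W) ^ α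

/-! The sample quantile is the `m`-th order statistic of the `|x_j|`, with `m = ⌈qk⌉`, so it is at
most `t` with probability a binomial tail evaluated at the distribution function of `|X|` at `t`. A
binomial tail is the distribution function of a beta law, hence the sample quantile is distributed
exactly as `G(U)`, where `G` is the quantile function of `|X|` and `U` is Beta(`m`, `k - m + 1`)
(`hasLaw_sampleQuantile`). The claim becomes an expansion of the variance of `h(U)` with `h(u) =
(G(u) / W)^α`.

Write `h(u) = h(q) + A (u - q) + B (u - q)^2 + R(u)`. Under the beta law the moments of `U - q` of
orders 1, 2, 3, 4 are `O(1/k)`, `(q - q^2)/k + O(1/k^2)`, `O(1/k^2)` and `O(1/k^2)`. So `A^2 (q -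
q^2)/k` is the main term and everything else is `O(1/k^2)`. The quadratic term is kept separately
because its cross term with the linear one is a signed third moment, of order `1/k^2`; an absolute
third moment would only give `k^(-3/2)`.

Two analytic facts about stable laws are needed. First, `h` must be `C^3` at `q`: the density `f` is
smooth since the characteristic function decays like `exp (-F |t|^α)`, and the inverse function
theorem applies once `f(w) + f(-w) > 0`. That positivity comes from stability alone: the set where
`f > 0` is closed under `(y, z) ↦ s y + u z` when `s^α + u^α = 1`, and each of its points is such a
combination (`fourierDensity_add_neg_pos`). Second, `h` is unbounded at `u = 1`, but the tail bound
`P(|X| > t) = O(t^(-α))` gives `h(u) = O(1 / (1 - u))`, whence `|R| ≤ C |u - q|^3 / (1 - u)`.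
Dividing a beta density by `1 - u` only lowers its second parameter, at the cost of a bounded
factor, so the weight is harmless. -/

/-! ### Fourier inversion for probability measures with integrable characteristic function. -/

-- Write `h` as the inverse transform of its Fourier transform and move the transform across the
-- pairing twice: first onto `μ`, which produces the characteristic function, then onto that
-- function.
open Filter Topology Set in
theorem integral_schwartz_eq_integral_fourier_charFun (μ : Measure ℝ) [IsProbabilityMeasure μ]
    (hint : Integrable (fun ξ : ℝ => charFun μ (2 * Real.pi * ξ))) (h : SchwartzMap ℝ ℂ) :
    ∫ x, h x ∂μ =
      ∫ x, h x * FourierTransform.fourier (fun ξ : ℝ => charFun μ (2 * Real.pi * ξ)) x := by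
  have hg : Integrable (FourierTransform.fourier (h : ℝ → ℂ)) := by
    rw [← SchwartzMap.fourier_coe]
    exact SchwartzMap.integrable _
  have hh : FourierTransformInv.fourierInv (FourierTransform.fourier (h : ℝ → ℂ)) = h :=
    Continuous.fourierInv_fourier_eq h.continuous h.integrable hg
  have h1 := VectorFourier.integral_fourierIntegral_smul_eq_flip (L := -innerₗ ℝ) (μ := μ)
    (ν := volume) (f := fun _ : ℝ => (1 : ℂ)) (g := FourierTransform.fourier (h : ℝ → ℂ))
    Real.continuous_fourierChar (by simpa using! continuous_inner.neg) (integrable_const _) hg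
  have h2 := VectorFourier.integral_fourierIntegral_smul_eq_flip (L := innerₗ ℝ) (μ := volume)
    (ν := volume) (f := (h : ℝ → ℂ)) (g := fun ξ : ℝ => charFun μ (2 * Real.pi * ξ))
    Real.continuous_fourierChar (by simpa using! continuous_inner) h.integrable hint
  have e1 : ∀ ξ : ℝ, VectorFourier.fourierIntegral Real.fourierChar μ (-innerₗ ℝ)
      (fun _ : ℝ => (1 : ℂ)) ξ = charFun μ (2 * Real.pi * ξ) := by
    intro ξ
    rw [charFun_apply_real, VectorFourier.fourierIntegral]
    congr with x
    rw [Circle.smul_def, Real.fourierChar_apply]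
    simp only [LinearMap.neg_apply, innerₗ_apply_apply, Real.inner_apply]
    rw [smul_eq_mul, mul_one]
    congr 1
    push_cast
    ring
  have e2 : ∀ x : ℝ, VectorFourier.fourierIntegral Real.fourierChar volume (-innerₗ ℝ).flip
      (FourierTransform.fourier (h : ℝ → ℂ)) x = h x := by
    intro x
    rw [← congrFun hh x, Real.fourierInv_eq, VectorFourier.fourierIntegral]
    congr with y
    simp [mul_comm]
  simp only [e1, e2, one_smul] at h1
  rw [← h1]
  have e3 : ∀ x : ℝ, VectorFourier.fourierIntegral Real.fourierChar volume (innerₗ ℝ).flip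
      (fun ξ : ℝ => charFun μ (2 * Real.pi * ξ)) x
      = FourierTransform.fourier (fun ξ : ℝ => charFun μ (2 * Real.pi * ξ)) x := by
    intro x
    rw [Real.fourier_eq, VectorFourier.fourierIntegral]
    congr with y
    simp [mul_comm]
  have e4 : ∀ x : ℝ, VectorFourier.fourierIntegral Real.fourierChar volume (innerₗ ℝ)
      (h : ℝ → ℂ) x = FourierTransform.fourier (h : ℝ → ℂ) x := fun x => rfl
  simp only [e3, e4, smul_eq_mul] at h2
  rw [← h2]
  congr with x
  simp [mul_comm]

/-- The real part of the inverse Fourier transform of the characteristic function. -/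
noncomputable def fourierDensity (μ : Measure ℝ) (x : ℝ) : ℝ :=
  (FourierTransform.fourier (fun ξ : ℝ => charFun μ (2 * Real.pi * ξ)) x).re

theorem integrable_charFun_two_pi {μ : Measure ℝ} (hint : Integrable (charFun μ)) :
    Integrable (fun ξ : ℝ => charFun μ (2 * Real.pi * ξ)) :=
  hint.comp_mul_left' (by positivity)

theorem continuous_fourierDensity {μ : Measure ℝ} (hint : Integrable (charFun μ)) :
    Continuous (fourierDensity μ) := by
  have := VectorFourier.fourierIntegral_continuous (L := innerₗ ℝ) (μ := volume)
    Real.continuous_fourierChar (by simpa using! continuous_inner)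
    (integrable_charFun_two_pi hint)
  exact Complex.continuous_re.comp this

theorem integral_bump_eq (μ : Measure ℝ) [IsProbabilityMeasure μ]
    (hint : Integrable (charFun μ)) {c : ℝ} (b : ContDiffBump c) :
    ∫ x, b x ∂μ = ∫ x, b x * fourierDensity μ x := by
  have hs : HasCompactSupport (fun x : ℝ => ((b x : ℝ) : ℂ)) :=
    b.hasCompactSupport.comp_left (g := fun y : ℝ => (y : ℂ)) (by simp)
  have hc : ContDiff ℝ ((⊤ : ℕ∞) : WithTop ℕ∞) (fun x : ℝ => ((b x : ℝ) : ℂ)) :=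
    Complex.ofRealCLM.contDiff.comp b.contDiff
  have h1 := integral_schwartz_eq_integral_fourier_charFun μ (integrable_charFun_two_pi hint)
    (hs.toSchwartzMap hc)
  have hcoe : ∀ x, (hs.toSchwartzMap hc) x = ((b x : ℝ) : ℂ) := fun x => rfl
  simp only [hcoe] at h1
  rw [integral_complex_ofReal] at h1
  have h2 := congrArg Complex.re h1
  rw [Complex.ofReal_re] at h2
  rw [h2]
  have hi : Integrable (fun x : ℝ => ((b x : ℝ) : ℂ) *
      FourierTransform.fourier (fun ξ : ℝ => charFun μ (2 * Real.pi * ξ)) x) := by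
    have hcont : Continuous
        (FourierTransform.fourier (fun ξ : ℝ => charFun μ (2 * Real.pi * ξ))) :=
      VectorFourier.fourierIntegral_continuous (L := innerₗ ℝ) (μ := volume)
        Real.continuous_fourierChar (by simpa using! continuous_inner)
        (integrable_charFun_two_pi hint)
    exact ((hc.continuous).mul hcont).integrable_of_hasCompactSupport hs.mul_right
  rw [← RCLike.re_eq_complex_re, ← integral_re hi]
  congr with x
  simp [fourierDensity]

open Filter Topology Set in
theorem measureReal_Icc_eq_integral_fourierDensity (μ : Measure ℝ) [IsProbabilityMeasure μ]
    (hint : Integrable (charFun μ)) {a b : ℝ} (hab : a < b) :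
    μ.real (Icc a b) = ∫ x in Icc a b, fourierDensity μ x := by
  set c := (a + b) / 2 with hc
  set r := (b - a) / 2 with hr
  have hr0 : 0 < r := by rw [hr]; linarith
  have hball : Icc a b = Metric.closedBall c r := by
    rw [Real.closedBall_eq_Icc, hc, hr]; congr 1 <;> ring
  have hn0 : ∀ n : ℕ, (0 : ℝ) < 1 / ((n : ℝ) + 1) := fun n => by positivity
  -- The inner ball is exactly `[a, b]` and the outer radius shrinks to `r`, so the limit is the
  -- indicator of the closed interval.
  let f : ∀ n : ℕ, ContDiffBump c := fun n => ⟨r, r + 1 / ((n : ℝ) + 1), hr0, by linarith [hn0 n]⟩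
  have hlim : ∀ x, Tendsto (fun n => f n x) atTop (𝓝 ((Icc a b).indicator (fun _ => (1 : ℝ)) x)) := by
    intro x
    by_cases hx : x ∈ Icc a b
    · rw [indicator_of_mem hx]
      refine tendsto_const_nhds.congr fun n => ((f n).one_of_mem_closedBall ?_).symm
      rw [← hball]; exact hx
    · rw [indicator_of_notMem hx]
      have hd : r < dist x c := by
        rw [hball, Metric.mem_closedBall, not_le] at hx; exact hx
      refine tendsto_const_nhds.congr' ?_
      have := (tendsto_one_div_add_atTop_nhds_zero_nat (𝕜 := ℝ)).eventually_lt_const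
        (sub_pos.2 hd)
      filter_upwards [this] with n hn
      exact ((f n).zero_of_le_dist (by show r + 1 / ((n : ℝ) + 1) ≤ _; linarith)).symm
  have h1 : Tendsto (fun n => ∫ x, f n x ∂μ) atTop
      (𝓝 (∫ x, (Icc a b).indicator (fun _ => (1 : ℝ)) x ∂μ)) := by
    refine tendsto_integral_of_dominated_convergence (fun _ => (1 : ℝ))
      (fun n => (f n).continuous.aestronglyMeasurable) (integrable_const _)
      (fun n => ae_of_all _ fun x => ?_) (ae_of_all _ hlim)
    rw [Real.norm_of_nonneg (f n).nonneg]; exact (f n).le_one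
  have h2 : Tendsto (fun n => ∫ x, f n x * fourierDensity μ x) atTop
      (𝓝 (∫ x, (Icc a b).indicator (fun _ => (1 : ℝ)) x * fourierDensity μ x)) := by
    have hcont := continuous_fourierDensity hint
    refine tendsto_integral_of_dominated_convergence
      ((Metric.closedBall c (r + 1)).indicator fun x => ‖fourierDensity μ x‖)
      (fun n => ((f n).continuous.mul hcont).aestronglyMeasurable) ?_
      (fun n => ae_of_all _ fun x => ?_) (ae_of_all _ fun x => (hlim x).mul_const _)
    · rw [integrable_indicator_iff Metric.isClosed_closedBall.measurableSet]
      exact hcont.norm.continuousOn.integrableOn_compact (isCompact_closedBall _ _)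
    · by_cases hx : x ∈ Metric.closedBall c (r + 1)
      · rw [indicator_of_mem hx, norm_mul]
        refine mul_le_of_le_one_left (norm_nonneg _) ?_
        rw [Real.norm_of_nonneg (f n).nonneg]; exact (f n).le_one
      · rw [indicator_of_notMem hx, (f n).zero_of_le_dist, zero_mul, norm_zero]
        rw [Metric.mem_closedBall, not_le] at hx
        have : 1 / ((n : ℝ) + 1) ≤ 1 := by
          rw [div_le_one (by positivity)]; linarith [n.cast_nonneg (α := ℝ)]
        show r + 1 / ((n : ℝ) + 1) ≤ _
        linarith
  simp only [integral_bump_eq μ hint] at h1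
  have h3 := tendsto_nhds_unique h1 h2
  rw [integral_indicator measurableSet_Icc] at h3
  simp only [integral_const, smul_eq_mul, mul_one, measureReal_restrict_apply_univ] at h3
  rw [h3, ← integral_indicator measurableSet_Icc]
  congr with x
  by_cases hx : x ∈ Icc a b <;> simp [hx]

open Filter Topology Set in
theorem fourierDensity_nonneg (μ : Measure ℝ) [IsProbabilityMeasure μ]
    (hint : Integrable (charFun μ)) (x : ℝ) : 0 ≤ fourierDensity μ x := by
  by_contra! hx
  have hcont := continuous_fourierDensity hint
  obtain ⟨ε, hε, hball⟩ := Metric.eventually_nhds_iff.1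
    (hcont.continuousAt.eventually_lt continuousAt_const (show fourierDensity μ x < 0 from hx))
  have hab : x < x + ε / 2 := by linarith
  have h := measureReal_Icc_eq_integral_fourierDensity μ hint hab
  have h0 : 0 ≤ μ.real (Icc x (x + ε / 2)) := measureReal_nonneg
  rw [h, integral_Icc_eq_integral_Ioc, ← intervalIntegral.integral_of_le hab.le] at h0
  have hneg : 0 < ∫ y in x..(x + ε / 2), -fourierDensity μ y := by
    refine intervalIntegral.intervalIntegral_pos_of_pos_on
      (hcont.neg.intervalIntegrable _ _) (fun y hy => ?_) hab
    have := @hball y (by rw [Real.dist_eq, abs_lt]; constructor <;> linarith [hy.1, hy.2])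
    simpa using! this
  rw [intervalIntegral.integral_neg] at hneg
  linarith

-- The interval formula needs `a < b`; atoms are excluded by letting `b` decrease to `a`.
open Filter Topology Set in
theorem measureReal_singleton_eq_zero_of_integrable_charFun (μ : Measure ℝ)
    [IsProbabilityMeasure μ] (hint : Integrable (charFun μ)) (a : ℝ) : μ.real {a} = 0 := by
  have hcont := continuous_fourierDensity hint
  have hle : ∀ b ∈ Ioi a, μ.real {a} ≤ ∫ x in a..b, fourierDensity μ x := by
    intro b hb
    rw [intervalIntegral.integral_of_le (le_of_lt hb), ← integral_Icc_eq_integral_Ioc,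
      ← measureReal_Icc_eq_integral_fourierDensity μ hint hb]
    exact measureReal_mono (by simpa using! le_of_lt hb)
  have hlim : Tendsto (fun b => ∫ x in a..b, fourierDensity μ x) (𝓝[>] a) (𝓝 0) := by
    have := (intervalIntegral.continuous_primitive
      (μ := volume) (fun x y => hcont.intervalIntegrable x y) a).tendsto a
    rw [intervalIntegral.integral_same] at this
    exact this.mono_left nhdsWithin_le_nhds
  refine le_antisymm (ge_of_tendsto hlim ?_) measureReal_nonneg
  filter_upwards [self_mem_nhdsWithin] with b hb using hle b hb

open Set in
theorem eq_withDensity_fourierDensity (μ : Measure ℝ) [IsProbabilityMeasure μ]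
    (hint : Integrable (charFun μ)) :
    μ = volume.withDensity (fun x => ENNReal.ofReal (fourierDensity μ x)) := by
  have hcont := continuous_fourierDensity hint
  refine Measure.ext_of_Icc' μ _ (fun a b _ => measure_ne_top _ _) fun a b hab => ?_
  have hi : IntegrableOn (fourierDensity μ) (Icc a b) :=
    hcont.continuousOn.integrableOn_compact isCompact_Icc
  rw [withDensity_apply _ measurableSet_Icc, ← ofReal_integral_eq_lintegral_ofReal hi
    (ae_of_all _ fun x => fourierDensity_nonneg μ hint x)]
  rcases hab.eq_or_lt with rfl | hab
  · have h0 : volume.restrict (Icc a a) = 0 := by simp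
    rw [h0, integral_zero_measure, ENNReal.ofReal_zero, Icc_self, ← measureReal_eq_zero_iff]
    exact measureReal_singleton_eq_zero_of_integrable_charFun μ hint a
  · rw [← measureReal_Icc_eq_integral_fourierDensity μ hint hab, ofReal_measureReal]

theorem abs_fourierDensity_le (μ : Measure ℝ) (x : ℝ) :
    |fourierDensity μ x| ≤ ∫ ξ : ℝ, ‖charFun μ (2 * Real.pi * ξ)‖ :=
  (Complex.abs_re_le_norm _).trans
    (VectorFourier.norm_fourierIntegral_le_integral_norm _ _ _ _ _)

theorem measure_ne_zero_of_fourierDensity_pos (μ : Measure ℝ) [IsProbabilityMeasure μ]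
    (hint : Integrable (charFun μ)) {U : Set ℝ} (hU : IsOpen U) {y : ℝ} (hy : y ∈ U)
    (hpos : 0 < fourierDensity μ y) : μ U ≠ 0 := by
  have hc := continuous_fourierDensity hint
  rw [eq_withDensity_fourierDensity μ hint, Ne, withDensity_apply_eq_zero
    (hc.measurable.ennreal_ofReal)]
  have hV : IsOpen ({x | 0 < fourierDensity μ x} ∩ U) := (isOpen_lt continuous_const hc).inter hU
  refine fun h0 => (hV.measure_pos volume ⟨y, hpos, hy⟩).ne' ?_
  simpa using! h0

theorem contDiff_fourierDensity {μ : Measure ℝ} {N : ℕ∞}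
    (hint : ∀ n : ℕ, (n : ℕ∞) ≤ N → Integrable fun t : ℝ => ‖t‖ ^ n * ‖charFun μ t‖) :
    ContDiff ℝ N (fourierDensity μ) := by
  have h : ContDiff ℝ N (FourierTransform.fourier (fun ξ : ℝ => charFun μ (2 * Real.pi * ξ))) := by
    refine Real.contDiff_fourier fun n hn => ?_
    have h1 := (hint n hn).comp_mul_left' (R := 2 * Real.pi) (by positivity)
    refine (h1.const_mul (((2 * Real.pi) ^ n)⁻¹)).congr (Filter.Eventually.of_forall fun ξ => ?_)
    have : ‖2 * Real.pi * ξ‖ = 2 * Real.pi * ‖ξ‖ := by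
      rw [norm_mul, Real.norm_of_nonneg (by positivity)]
    simp only [this, mul_pow]
    field_simp
  exact Complex.reCLM.contDiff.comp h

/-! ### Stable laws: smooth density and the convolution identity. -/

open Set in
theorem MeasureTheory.IntegrableOn.integrable_comp_abs {f : ℝ → ℝ} (hf : IntegrableOn f (Ioi 0)) :
    Integrable fun x => f |x| := by
  have h1 : IntegrableOn (fun x => f |x|) (Ioi 0) :=
    hf.congr_fun (fun x hx => by simp only [abs_of_pos (mem_Ioi.1 hx)]) measurableSet_Ioi
  have h2 : IntegrableOn (fun x => f |x|) (Iio 0) := by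
    rw [← neg_zero] at h1
    refine h1.comp_neg_Iio.congr_fun (fun x _ => ?_) measurableSet_Iio
    simp only [abs_neg]
  rw [← integrableOn_univ, ← Iio_union_Ici (a := (0 : ℝ))]
  exact h2.union (Iff.mpr integrableOn_Ici_iff_integrableOn_Ioi h1)

namespace IsStableLaw

variable {α β F : ℝ} {μ : Measure ℝ}

theorem norm_charFun (h : IsStableLaw α β F μ) (t : ℝ) :
    ‖charFun μ t‖ = Real.exp (-F * |t| ^ α) := by
  rw [h.charFun_eq, Complex.norm_exp]
  congr 1
  rw [← Complex.ofReal_neg, Complex.re_ofReal_mul, Complex.sub_re, Complex.I_mul_re,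
    Complex.ofReal_im, Complex.one_re]
  ring

open Set in
theorem integrable_norm_pow_mul_norm_charFun (h : IsStableLaw α β F μ) (hα : 0 < α) (hF : 0 < F)
    (n : ℕ) : Integrable fun t : ℝ => ‖t‖ ^ n * ‖charFun μ t‖ := by
  have h0 := integrableOn_rpow_mul_exp_neg_mul_rpow (s := n) (p := α) (b := F)
    (by linarith [n.cast_nonneg (α := ℝ)]) hα hF
  have h1 := MeasureTheory.IntegrableOn.integrable_comp_abs h0
  simpa [h.norm_charFun] using! h1

theorem integrable_charFun (h : IsStableLaw α β F μ) (hα : 0 < α) (hF : 0 < F) :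
    Integrable (charFun μ) := by
  have := h.isProbabilityMeasure
  have h1 := h.integrable_norm_pow_mul_norm_charFun hα hF 0
  simp only [pow_zero, one_mul] at h1
  exact (integrable_norm_iff (stronglyMeasurable_charFun.aestronglyMeasurable)).1 h1

theorem contDiff_fourierDensity (h : IsStableLaw α β F μ) (hα : 0 < α) (hF : 0 < F) :
    ContDiff ℝ ((⊤ : ℕ∞) : WithTop ℕ∞) (fourierDensity μ) :=
  _root_.contDiff_fourierDensity fun n _ => h.integrable_norm_pow_mul_norm_charFun hα hF n

/-- Stability: `s X + u X'` has the law of `X` for independent copies `X`, `X'`. The skewness factor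
survives because positive scaling preserves `sign t`. -/
theorem charFun_mul_charFun (h : IsStableLaw α β F μ) {s u : ℝ} (hs : 0 < s) (hu : 0 < u)
    (hsu : s ^ α + u ^ α = 1) (t : ℝ) :
    charFun μ (s * t) * charFun μ (u * t) = charFun μ t := by
  have hsign : ∀ r : ℝ, 0 < r → Real.sign (r * t) = Real.sign t := by
    intro r hr
    rcases lt_trichotomy t 0 with ht | rfl | ht
    · rw [Real.sign_of_neg ht, Real.sign_of_neg (mul_neg_of_pos_of_neg hr ht)]
    · rw [mul_zero]
    · rw [Real.sign_of_pos ht, Real.sign_of_pos (mul_pos hr ht)]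
  simp only [h.charFun_eq, hsign s hs, hsign u hu]
  rw [← Complex.exp_add, ← add_mul]
  congr 2
  rw [← neg_add, ← Complex.ofReal_add, ← mul_add, abs_mul, abs_mul, abs_of_pos hs, abs_of_pos hu,
    Real.mul_rpow hs.le (abs_nonneg t), Real.mul_rpow hu.le (abs_nonneg t), ← add_mul, hsu, one_mul]

/-- The convolution identity for the density: condition on `X = y` in `s X + u X'`. One factor is
unfolded as an integral over `μ`, Fubini is applied, and the frequency is rescaled by `u`. -/
theorem fourier_charFun_eq_integral (h : IsStableLaw α β F μ) (hα : 0 < α) (hF : 0 < F)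
    {s u : ℝ} (hs : 0 < s) (hu : 0 < u) (hsu : s ^ α + u ^ α = 1) (x : ℝ) :
    FourierTransform.fourier (fun ξ : ℝ => charFun μ (2 * Real.pi * ξ)) x =
      ∫ y, (u⁻¹ : ℂ) * FourierTransform.fourier (fun ξ : ℝ => charFun μ (2 * Real.pi * ξ))
        ((x - s * y) / u) ∂μ := by
  have := h.isProbabilityMeasure
  have hint := integrable_charFun_two_pi (h.integrable_charFun hα hF)
  set ψ : ℝ → ℂ := fun ξ : ℝ => charFun μ (2 * Real.pi * ξ) with hψ
  have hψu : Integrable (fun ξ : ℝ => ψ (u * ξ)) := hint.comp_mul_left' hu.ne'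
  have hsplit : ∀ ξ, ψ ξ = (∫ y, Complex.exp ((2 * Real.pi * (s * ξ) * y : ℝ) * Complex.I) ∂μ)
      * ψ (u * ξ) := by
    intro ξ
    rw [hψ]
    simp only
    rw [← h.charFun_mul_charFun hs hu hsu, charFun_apply_real]
    congr 2
    · congr with y
      congr 2
      push_cast; ring
    · ring
  let k : ℝ → ℝ → ℂ := fun ξ y => Complex.exp ((-2 * Real.pi * ξ * (x - s * y) : ℝ) * Complex.I)
    * ψ (u * ξ)
  have hk : Integrable (Function.uncurry k) (volume.prod μ) := by
    refine Integrable.bdd_mul (c := 1) (f := fun p : ℝ × ℝ =>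
      Complex.exp ((-2 * Real.pi * p.1 * (x - s * p.2) : ℝ) * Complex.I))
      (g := fun p : ℝ × ℝ => ψ (u * p.1)) ?_ ?_ ?_
    · exact hψu.comp_fst μ
    · exact Continuous.aestronglyMeasurable (by fun_prop)
    · exact ae_of_all _ fun p => (Complex.norm_exp_ofReal_mul_I _).le
  calc FourierTransform.fourier ψ x
      = ∫ ξ, ∫ y, k ξ y ∂μ := by
        rw [Real.fourier_real_eq_integral_exp_smul]
        congr with ξ
        rw [hsplit ξ, smul_eq_mul, ← mul_assoc, ← integral_const_mul, ← integral_mul_const]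
        congr with y
        simp only [k]
        rw [← Complex.exp_add]
        congr 2
        push_cast; ring
    _ = ∫ y, (∫ ξ, k ξ y) ∂μ := integral_integral_swap hk
    _ = _ := by
        congr with y
        rw [Real.fourier_real_eq_integral_exp_smul]
        have hsub := Measure.integral_comp_mul_left (fun η : ℝ =>
          Complex.exp ((-2 * Real.pi * η * ((x - s * y) / u) : ℝ) * Complex.I) • ψ η) u
        rw [abs_of_pos (inv_pos.2 hu)] at hsub
        rw [← Complex.ofReal_inv, ← Complex.real_smul, ← hsub]
        congr with ξ
        simp only [k, smul_eq_mul]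
        congr 3
        norm_cast
        field_simp

theorem fourierDensity_eq_integral (h : IsStableLaw α β F μ) (hα : 0 < α) (hF : 0 < F)
    {s u : ℝ} (hs : 0 < s) (hu : 0 < u) (hsu : s ^ α + u ^ α = 1) (x : ℝ) :
    fourierDensity μ x = ∫ y, u⁻¹ * fourierDensity μ ((x - s * y) / u) ∂μ := by
  have := h.isProbabilityMeasure
  have hint := integrable_charFun_two_pi (h.integrable_charFun hα hF)
  have hc : Continuous
      (FourierTransform.fourier (fun ξ : ℝ => charFun μ (2 * Real.pi * ξ))) :=
    VectorFourier.fourierIntegral_continuous (L := innerₗ ℝ) (μ := volume)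
      Real.continuous_fourierChar (by simpa using! continuous_inner) hint
  have hi : Integrable (fun y => (u⁻¹ : ℂ) *
      FourierTransform.fourier (fun ξ : ℝ => charFun μ (2 * Real.pi * ξ)) ((x - s * y) / u)) μ := by
    refine Integrable.const_mul (Integrable.of_bound (C := ∫ ξ : ℝ, ‖charFun μ (2 * Real.pi * ξ)‖)
      (hc.comp (by fun_prop)).aestronglyMeasurable (ae_of_all _ fun y => ?_)) _
    exact VectorFourier.norm_fourierIntegral_le_integral_norm _ _ _ _ _
  rw [fourierDensity, h.fourier_charFun_eq_integral hα hF hs hu hsu, ← RCLike.re_eq_complex_re,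
    ← integral_re hi]
  congr with y
  rw [RCLike.re_eq_complex_re, ← Complex.ofReal_inv, Complex.re_ofReal_mul]
  rfl

theorem ae_fourierDensity_pos (h : IsStableLaw α β F μ) (hα : 0 < α) (hF : 0 < F) :
    ∀ᵐ y ∂μ, 0 < fourierDensity μ y := by
  have := h.isProbabilityMeasure
  have hint := h.integrable_charFun hα hF
  have hm : Measurable fun x => ENNReal.ofReal (fourierDensity μ x) :=
    (continuous_fourierDensity hint).measurable.ennreal_ofReal
  rw [eq_withDensity_fourierDensity μ hint, ae_withDensity_iff hm,
    ← eq_withDensity_fourierDensity μ hint]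
  refine ae_of_all _ fun x hx => ?_
  simpa using hx

theorem fourierDensity_combination_pos (h : IsStableLaw α β F μ) (hα : 0 < α) (hF : 0 < F)
    {s u : ℝ} (hs : 0 < s) (hu : 0 < u) (hsu : s ^ α + u ^ α = 1) {y z : ℝ}
    (hy : 0 < fourierDensity μ y) (hz : 0 < fourierDensity μ z) :
    0 < fourierDensity μ (s * y + u * z) := by
  have := h.isProbabilityMeasure
  have hint := h.integrable_charFun hα hF
  have hc := continuous_fourierDensity hint
  set x := s * y + u * z with hx
  have hci : Continuous fun y' => u⁻¹ * fourierDensity μ ((x - s * y') / u) := by fun_prop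
  have hnn : ∀ y', 0 ≤ u⁻¹ * fourierDensity μ ((x - s * y') / u) := fun y' =>
    mul_nonneg (inv_nonneg.2 hu.le) (fourierDensity_nonneg μ hint _)
  rw [h.fourierDensity_eq_integral hα hF hs hu hsu, integral_pos_iff_support_of_nonneg hnn]
  · refine pos_iff_ne_zero.2 fun h0 => measure_ne_zero_of_fourierDensity_pos μ hint
      (hci.isOpen_support) (y := y) ?_ hy h0
    have : (x - s * y) / u = z := by rw [hx]; field_simp; ring
    rw [Function.mem_support, this]
    exact (mul_pos (inv_pos.2 hu) hz).ne'
  · refine Integrable.of_bound (C := u⁻¹ * ∫ ξ : ℝ, ‖charFun μ (2 * Real.pi * ξ)‖)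
      hci.aestronglyMeasurable (ae_of_all _ fun y' => ?_)
    rw [Real.norm_eq_abs, abs_mul, abs_of_pos (inv_pos.2 hu)]
    exact mul_le_mul_of_nonneg_left (abs_fourierDensity_le μ _) (inv_nonneg.2 hu.le)

/-- Converse of `fourierDensity_combination_pos`: otherwise the convolution integrand would vanish
at `μ`-almost every `y`, since almost every `y` has positive density. -/
theorem exists_of_fourierDensity_pos (h : IsStableLaw α β F μ) (hα : 0 < α) (hF : 0 < F)
    {s u : ℝ} (hs : 0 < s) (hu : 0 < u) (hsu : s ^ α + u ^ α = 1) {x : ℝ}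
    (hx : 0 < fourierDensity μ x) :
    ∃ y z, 0 < fourierDensity μ y ∧ 0 < fourierDensity μ z ∧ x = s * y + u * z := by
  have := h.isProbabilityMeasure
  have hint := h.integrable_charFun hα hF
  by_contra! hcon
  have h0 : (fun y => u⁻¹ * fourierDensity μ ((x - s * y) / u)) =ᵐ[μ] fun _ => 0 := by
    filter_upwards [h.ae_fourierDensity_pos hα hF] with y hy
    have hz : ¬ 0 < fourierDensity μ ((x - s * y) / u) := fun hz =>
      hcon y _ hy hz (by field_simp; ring)
    rw [le_antisymm (not_lt.1 hz) (fourierDensity_nonneg μ hint _), mul_zero]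
  rw [h.fourierDensity_eq_integral hα hF hs hu hsu, integral_congr_ae h0] at hx
  simp at hx

theorem exists_fourierDensity_pos (h : IsStableLaw α β F μ) (hα : 0 < α) (hF : 0 < F) :
    ∃ y, 0 < fourierDensity μ y := by
  have := h.isProbabilityMeasure
  exact (h.ae_fourierDensity_pos hα hF).exists

end IsStableLaw

/-! ### Where the stable density is positive. -/

namespace IsStableLaw

variable {α β F : ℝ} {μ : Measure ℝ}

/-- Combine `y` with itself: `t^(1/α) + (1 - t)^(1/α)` moves continuously from 1 at `t = 0` to `κ =
2^(1 - 1/α)` at `t = 1/2`. Iterated, this fills the ray outward from `y` when `α > 1` and inward to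
0 when `α < 1`. For `α = 1` the interval degenerates. -/
theorem fourierDensity_mul_pos_of_mem_uIcc (h : IsStableLaw α β F μ) (hα : 0 < α) (hF : 0 < F)
    {y c : ℝ} (hy : 0 < fourierDensity μ y) (hc : c ∈ Set.uIcc 1 ((2 : ℝ) ^ (1 - α⁻¹))) :
    0 < fourierDensity μ (c * y) := by
  rcases eq_or_ne c 1 with rfl | hc1
  · rwa [one_mul]
  have hα' : 0 < α⁻¹ := inv_pos.2 hα
  have hcont : Continuous fun t : ℝ => t ^ α⁻¹ + (1 - t) ^ α⁻¹ :=
    (Real.continuous_rpow_const hα'.le).add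
      ((Real.continuous_rpow_const hα'.le).comp (continuous_const.sub continuous_id))
  have h0 : (0 : ℝ) ^ α⁻¹ + (1 - 0) ^ α⁻¹ = 1 := by
    rw [Real.zero_rpow hα'.ne', sub_zero, Real.one_rpow, zero_add]
  have h1 : (1 / 2 : ℝ) ^ α⁻¹ + (1 - 1 / 2) ^ α⁻¹ = (2 : ℝ) ^ (1 - α⁻¹) := by
    rw [Real.rpow_sub two_pos, Real.rpow_one, show (1 - 1 / 2 : ℝ) = 1 / 2 by norm_num,
      Real.div_rpow zero_le_one zero_le_two, Real.one_rpow]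
    ring
  have hivt := intermediate_value_uIcc (f := fun t : ℝ => t ^ α⁻¹ + (1 - t) ^ α⁻¹)
    (a := 0) (b := 1 / 2) hcont.continuousOn
  simp only [h0, h1] at hivt
  obtain ⟨t, ht, htc⟩ := hivt hc
  rw [Set.uIcc_of_le (by norm_num)] at ht
  have ht0 : 0 < t := by
    refine lt_of_le_of_ne ht.1 fun h00 => hc1 ?_
    rw [← htc, ← h00]
    exact h0
  have ht1 : 0 < 1 - t := by linarith [ht.2]
  have hcomb := h.fourierDensity_combination_pos hα hF (Real.rpow_pos_of_pos ht0 α⁻¹)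
    (Real.rpow_pos_of_pos ht1 α⁻¹)
    (by rw [Real.rpow_inv_rpow ht0.le hα.ne', Real.rpow_inv_rpow ht1.le hα.ne']; ring) hy hy
  rwa [← htc, add_mul]

theorem fourierDensity_pow_mul_pos (h : IsStableLaw α β F μ) (hα : 0 < α) (hF : 0 < F)
    {y : ℝ} (hy : 0 < fourierDensity μ y) (n : ℕ) :
    0 < fourierDensity μ (((2 : ℝ) ^ (1 - α⁻¹)) ^ n * y) := by
  induction n with
  | zero => simpa using hy
  | succ n ih =>
    rw [pow_succ', mul_assoc]
    exact h.fourierDensity_mul_pos_of_mem_uIcc hα hF ih Set.right_mem_uIcc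

theorem two_mul_rpow_neg_inv (α : ℝ) : 2 * (1 / 2 : ℝ) ^ α⁻¹ = (2 : ℝ) ^ (1 - α⁻¹) := by
  rw [Real.rpow_sub two_pos, Real.rpow_one, Real.div_rpow zero_le_one zero_le_two, Real.one_rpow]
  ring

theorem exists_half_sum (h : IsStableLaw α β F μ) (hα : 0 < α) (hF : 0 < F) {x : ℝ}
    (hx : 0 < fourierDensity μ x) :
    ∃ y z, 0 < fourierDensity μ y ∧ 0 < fourierDensity μ z ∧
      x = (2 : ℝ) ^ (1 - α⁻¹) * ((y + z) / 2) := by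
  have hp : (0 : ℝ) < (1 / 2 : ℝ) ^ α⁻¹ := by positivity
  obtain ⟨y, z, hy, hz, hyz⟩ := h.exists_of_fourierDensity_pos hα hF hp hp
    (by rw [Real.rpow_inv_rpow (by norm_num) hα.ne']; norm_num) hx
  refine ⟨y, z, hy, hz, ?_⟩
  rw [hyz, ← two_mul_rpow_neg_inv]
  ring

-- Supplies a starting point near 0 for the outward rays. If there were none, all points of positive
-- density would have one sign, and the averaging identity of `exists_half_sum` would push them to
-- infinity.
open Filter Topology in
theorem exists_ne_zero_abs_le_fourierDensity_pos (h : IsStableLaw α β F μ) (hα : 1 < α)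
    (hF : 0 < F) {w : ℝ} (hw : 0 < w) : ∃ y, y ≠ 0 ∧ |y| ≤ w ∧ 0 < fourierDensity μ y := by
  have hα0 : 0 < α := by linarith
  have hα' : 0 < α⁻¹ := inv_pos.2 hα0
  have := h.isProbabilityMeasure
  have hc := continuous_fourierDensity (h.integrable_charFun hα0 hF)
  by_cases hzero : 0 < fourierDensity μ 0
  · obtain ⟨ε, hε, hball⟩ := Metric.eventually_nhds_iff.1
      (continuousAt_const.eventually_lt hc.continuousAt hzero)
    have hm : 0 < min w (ε / 2) := by positivity
    refine ⟨min w (ε / 2), hm.ne', ?_, hball ?_⟩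
    · rw [abs_of_pos hm]; exact min_le_left _ _
    · rw [Real.dist_eq, sub_zero, abs_of_pos hm]
      exact (min_le_right _ _).trans_lt (by linarith)
  by_contra! hcon
  have hne : ∀ y, 0 < fourierDensity μ y → y ≠ 0 := by
    rintro y hy rfl
    exact hzero hy
  have hbig : ∀ y, 0 < fourierDensity μ y → w < |y| := fun y hy => by
    by_contra! hle
    exact absurd hy (not_lt.2 (hcon y (hne y hy) hle))
  -- Admissible combinations of points of opposite sign pass through 0, which has already been
  -- excluded.
  have hopp : ∀ y z, 0 < fourierDensity μ y → 0 < fourierDensity μ z → 0 < y → z < 0 → False := by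
    intro y z hy hz hy0 hz0
    have hcont : Continuous fun t : ℝ => t ^ α⁻¹ * y + (1 - t) ^ α⁻¹ * z :=
      ((Real.continuous_rpow_const hα'.le).mul continuous_const).add
        (((Real.continuous_rpow_const hα'.le).comp (continuous_const.sub continuous_id)).mul
          continuous_const)
    have hivt := intermediate_value_Icc zero_le_one hcont.continuousOn
    simp only [Real.zero_rpow hα'.ne', sub_zero, Real.one_rpow, sub_self, zero_mul, one_mul,
      zero_add, add_zero] at hivt
    obtain ⟨t, ht, ht0⟩ := hivt ⟨hz0.le, hy0.le⟩
    simp only at ht0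
    have h1 : 0 < t := lt_of_le_of_ne ht.1 (by
      rintro rfl
      simp [Real.zero_rpow hα'.ne'] at ht0
      exact hz0.ne ht0)
    have h2 : 0 < 1 - t := by
      refine sub_pos.2 (lt_of_le_of_ne ht.2 ?_)
      rintro rfl
      simp [Real.zero_rpow hα'.ne'] at ht0
      exact hy0.ne' ht0
    have hcomb := h.fourierDensity_combination_pos hα0 hF (Real.rpow_pos_of_pos h1 α⁻¹)
      (Real.rpow_pos_of_pos h2 α⁻¹)
      (by rw [Real.rpow_inv_rpow h1.le hα0.ne', Real.rpow_inv_rpow h2.le hα0.ne']; ring) hy hz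
    rw [ht0] at hcomb
    exact hzero hcomb
  have hκ : 1 < (2 : ℝ) ^ (1 - α⁻¹) :=
    Real.one_lt_rpow one_lt_two (sub_pos.2 (inv_lt_one_of_one_lt₀ hα))
  -- With equal signs `|x| = κ (|y| + |z|) / 2`, so each application of the identity multiplies the
  -- lower bound by `κ > 1`.
  have hgrow : ∀ n : ℕ, ∀ x, 0 < fourierDensity μ x → ((2 : ℝ) ^ (1 - α⁻¹)) ^ n * w < |x| := by
    intro n
    induction n with
    | zero => simpa using hbig
    | succ n ih =>
      intro x hx
      obtain ⟨y, z, hy, hz, rfl⟩ := h.exists_half_sum hα0 hF hx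
      have hyz : |y + z| = |y| + |z| := by
        rw [abs_add_eq_add_abs_iff]
        rcases lt_or_gt_of_ne (hne y hy) with h1 | h1 <;> rcases lt_or_gt_of_ne (hne z hz) with h2 | h2
        · exact Or.inr ⟨h1.le, h2.le⟩
        · exact (hopp z y hz hy h2 h1).elim
        · exact (hopp y z hy hz h1 h2).elim
        · exact Or.inl ⟨h1.le, h2.le⟩
      rw [pow_succ', mul_assoc, abs_mul, abs_of_pos (by linarith), abs_div, hyz, abs_two]
      refine mul_lt_mul_of_pos_left ?_ (by linarith)
      linarith [ih y hy, ih z hz]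
  obtain ⟨x, hx⟩ := h.exists_fourierDensity_pos hα0 hF
  obtain ⟨n, hn⟩ := pow_unbounded_of_one_lt (|x| / w) hκ
  rw [div_lt_iff₀ hw] at hn
  exact lt_asymm hn (hgrow n x hx)

/-- If the points of positive density were bounded, then since `κ < 1` the averaging identity would
shrink the bound to 0; but that set is open and nonempty, so it has a nonzero point. -/
theorem exists_le_abs_fourierDensity_pos (h : IsStableLaw α β F μ) (hα0 : 0 < α) (hα : α < 1)
    (hF : 0 < F) (w : ℝ) : ∃ y, w ≤ |y| ∧ 0 < fourierDensity μ y := by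
  have := h.isProbabilityMeasure
  have hc := continuous_fourierDensity (h.integrable_charFun hα0 hF)
  by_contra! hcon
  have hsmall : ∀ y, 0 < fourierDensity μ y → |y| < w := fun y hy => by
    by_contra! hle
    exact absurd hy (not_lt.2 (hcon y hle))
  have hκ0 : 0 < (2 : ℝ) ^ (1 - α⁻¹) := by positivity
  have hκ : (2 : ℝ) ^ (1 - α⁻¹) < 1 :=
    Real.rpow_lt_one_of_one_lt_of_neg one_lt_two (sub_neg.2 ((one_lt_inv₀ hα0).2 hα))
  have hshrink : ∀ n : ℕ, ∀ x, 0 < fourierDensity μ x → |x| < ((2 : ℝ) ^ (1 - α⁻¹)) ^ n * w := by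
    intro n
    induction n with
    | zero => simpa using hsmall
    | succ n ih =>
      intro x hx
      obtain ⟨y, z, hy, hz, rfl⟩ := h.exists_half_sum hα0 hF hx
      rw [pow_succ', mul_assoc, abs_mul, abs_of_pos hκ0, abs_div, abs_two]
      refine mul_lt_mul_of_pos_left ?_ hκ0
      linarith [ih y hy, ih z hz, abs_add_le y z]
  obtain ⟨x, hx0, hx⟩ : ∃ x, x ≠ 0 ∧ 0 < fourierDensity μ x := by
    obtain ⟨x, hx⟩ := h.exists_fourierDensity_pos hα0 hF
    obtain ⟨ε, hε, hball⟩ := Metric.eventually_nhds_iff.1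
      (continuousAt_const.eventually_lt hc.continuousAt hx)
    rcases eq_or_ne x 0 with rfl | hx0
    · refine ⟨ε / 2, by positivity, hball ?_⟩
      rw [Real.dist_eq, sub_zero, abs_of_pos (by positivity)]
      linarith
    · exact ⟨x, hx0, hx⟩
  have hw : 0 < w := (abs_nonneg x).trans_lt (hsmall x hx)
  obtain ⟨n, hn⟩ := exists_pow_lt_of_lt_one (div_pos (abs_pos.2 hx0) hw) hκ
  rw [lt_div_iff₀ hw] at hn
  exact lt_asymm hn (hshrink n x hx)

/-- The sum is what the density of `|X|` requires, and it lets one ray suffice: the construction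
reaches whichever of `w`, `-w` has the sign of the starting point. A power `κ^n` comes within a
factor `κ` of the target, and a final intermediate factor hits it exactly. -/
theorem fourierDensity_add_neg_pos (h : IsStableLaw α β F μ) (hα0 : 0 < α) (hα1 : α ≠ 1)
    (hF : 0 < F) {w : ℝ} (hw : 0 < w) :
    0 < fourierDensity μ w + fourierDensity μ (-w) := by
  have := h.isProbabilityMeasure
  have hnn := fourierDensity_nonneg μ (h.integrable_charFun hα0 hF)
  suffices hs : ∃ y ≠ 0, 0 < fourierDensity μ (w / |y| * y) by
    obtain ⟨y, hy0, hy⟩ := hs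
    rcases lt_or_gt_of_ne hy0 with h1 | h1
    · rw [abs_of_neg h1, show w / -y * y = -w by field_simp] at hy
      linarith [hnn w]
    · rw [abs_of_pos h1, show w / y * y = w by field_simp] at hy
      linarith [hnn (-w)]
  have hκ0 : 0 < (2 : ℝ) ^ (1 - α⁻¹) := by positivity
  rcases lt_or_gt_of_ne hα1 with hα | hα
  · obtain ⟨y, hwy, hy⟩ := h.exists_le_abs_fourierDensity_pos hα0 hα hF w
    have hy0 : 0 < |y| := hw.trans_le hwy
    have hκ : (2 : ℝ) ^ (1 - α⁻¹) < 1 :=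
      Real.rpow_lt_one_of_one_lt_of_neg one_lt_two (sub_neg.2 ((one_lt_inv₀ hα0).2 hα))
    obtain ⟨n, hn1, hn2⟩ := exists_nat_pow_near_of_lt_one (div_pos hw hy0)
      ((div_le_one hy0).2 hwy) hκ0 hκ
    refine ⟨y, abs_pos.1 hy0, ?_⟩
    have hc := h.fourierDensity_mul_pos_of_mem_uIcc hα0 hF (h.fourierDensity_pow_mul_pos hα0 hF hy n)
      (c := w / |y| / ((2 : ℝ) ^ (1 - α⁻¹)) ^ n) (by
        rw [Set.uIcc_of_ge hκ.le]
        refine ⟨?_, (div_le_one (by positivity)).2 hn2⟩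
        rw [le_div_iff₀ (by positivity), ← pow_succ']
        exact hn1.le)
    rwa [← mul_assoc, div_mul_cancel₀ _ (by positivity)] at hc
  · obtain ⟨y, hy0, hyw, hy⟩ := h.exists_ne_zero_abs_le_fourierDensity_pos hα hF hw
    have hy0' : 0 < |y| := abs_pos.2 hy0
    have hκ : 1 < (2 : ℝ) ^ (1 - α⁻¹) :=
      Real.one_lt_rpow one_lt_two (sub_pos.2 (inv_lt_one_of_one_lt₀ hα))
    obtain ⟨n, hn1, hn2⟩ := exists_nat_pow_near ((one_le_div hy0').2 hyw) hκ
    refine ⟨y, hy0, ?_⟩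
    have hc := h.fourierDensity_mul_pos_of_mem_uIcc hα0 hF (h.fourierDensity_pow_mul_pos hα0 hF hy n)
      (c := w / |y| / ((2 : ℝ) ^ (1 - α⁻¹)) ^ n) (by
        rw [Set.uIcc_of_le hκ.le]
        refine ⟨(one_le_div (by positivity)).2 hn1, ?_⟩
        rw [div_le_iff₀ (by positivity), ← pow_succ']
        exact hn2.le)
    rwa [← mul_assoc, div_mul_cancel₀ _ (by positivity)] at hc

end IsStableLaw

/-! ### Quantiles and the law of the absolute value. -/

-- Right continuity makes the infimum attained, giving the Galois connection between quantile and
-- distribution function. It serves both for laws and for the empirical counting function.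
open Filter Topology Set in
theorem Monotone.csInf_le_iff_le {N : ℝ → ℝ} (hN : Monotone N)
    (hc : ∀ t, ContinuousWithinAt N (Ici t) t) {c : ℝ} (hne : ∃ t, c ≤ N t)
    (hlt : ∃ t, N t < c) (t : ℝ) : sInf {t | c ≤ N t} ≤ t ↔ c ≤ N t := by
  obtain ⟨t₀, ht₀⟩ := hlt
  have hbdd : BddBelow {t | c ≤ N t} :=
    ⟨t₀, fun s hs => le_of_not_gt fun hlt => (ht₀.trans_le (le_trans hs (hN hlt.le))).false⟩
  refine ⟨fun h => ?_, fun h => csInf_le hbdd h⟩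
  have hgt : ∀ s ∈ Ioi t, c ≤ N s := fun s hs => by
    obtain ⟨r, hr, hrs⟩ := exists_lt_of_csInf_lt hne (lt_of_le_of_lt h hs)
    exact le_trans hr (hN hrs.le)
  refine _root_.ge_of_tendsto ((hc t).mono_left (nhdsWithin_mono t Ioi_subset_Ici_self)) ?_
  filter_upwards [self_mem_nhdsWithin] with s hs using hgt s hs

theorem lawQuantile_le_iff (μ : Measure ℝ) [IsProbabilityMeasure μ] {u : ℝ}
    (hu : u ∈ Set.Ioo (0 : ℝ) 1) (t : ℝ) : lawQuantile μ u ≤ t ↔ u ≤ cdf μ t := by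
  refine (monotone_cdf μ).csInf_le_iff_le (fun t => (cdf μ).right_continuous t) ?_ ?_ t
  · obtain ⟨t, ht⟩ := ((tendsto_cdf_atTop μ).eventually_const_lt hu.2).exists
    exact ⟨t, ht.le⟩
  · exact ((tendsto_cdf_atBot μ).eventually_lt_const hu.1).exists

instance (μ : Measure ℝ) [IsProbabilityMeasure μ] : IsProbabilityMeasure (absLaw μ) :=
  Measure.isProbabilityMeasure_map (by fun_prop)

theorem cdf_absLaw (μ : Measure ℝ) [IsProbabilityMeasure μ] (t : ℝ) :
    cdf (absLaw μ) t = μ.real {x | |x| ≤ t} := by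
  rw [cdf_eq_real, absLaw, map_measureReal_apply (by fun_prop) measurableSet_Iic]
  rfl

theorem cdf_absLaw_of_neg (μ : Measure ℝ) [IsProbabilityMeasure μ] {t : ℝ} (ht : t < 0) :
    cdf (absLaw μ) t = 0 := by
  rw [cdf_absLaw]
  have : {x : ℝ | |x| ≤ t} = ∅ :=
    Set.eq_empty_of_forall_notMem fun x hx => (ht.trans_le ((abs_nonneg x).trans' le_rfl)).not_ge hx
  rw [this, measureReal_empty]

/-- The distribution function on `[0, ∞)` of the absolute value. -/
noncomputable def absPrimitive (μ : Measure ℝ) (t : ℝ) : ℝ :=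
  ∫ x in (0 : ℝ)..t, (fourierDensity μ x + fourierDensity μ (-x))

theorem hasDerivAt_absPrimitive {μ : Measure ℝ} (hint : Integrable (charFun μ)) (t : ℝ) :
    HasDerivAt (absPrimitive μ) (fourierDensity μ t + fourierDensity μ (-t)) t := by
  have hc := continuous_fourierDensity hint
  have hc2 : Continuous fun x => fourierDensity μ x + fourierDensity μ (-x) := by fun_prop
  exact hc2.integral_hasStrictDerivAt 0 t |>.hasDerivAt

theorem cdf_absLaw_of_nonneg (μ : Measure ℝ) [IsProbabilityMeasure μ]
    (hint : Integrable (charFun μ)) {t : ℝ} (ht : 0 ≤ t) :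
    cdf (absLaw μ) t = absPrimitive μ t := by
  have hc := continuous_fourierDensity hint
  have hcn : Continuous fun x => fourierDensity μ (-x) := by fun_prop
  have hset : {x : ℝ | |x| ≤ t} = Set.Icc (-t) t := by ext x; simp [abs_le]
  rw [cdf_absLaw, hset]
  rcases ht.eq_or_lt with rfl | ht
  · rw [neg_zero, Set.Icc_self, measureReal_singleton_eq_zero_of_integrable_charFun μ hint,
      absPrimitive, intervalIntegral.integral_same]
  rw [measureReal_Icc_eq_integral_fourierDensity μ hint (by linarith),
    integral_Icc_eq_integral_Ioc, ← intervalIntegral.integral_of_le (by linarith), absPrimitive,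
    intervalIntegral.integral_add (hc.intervalIntegrable _ _) (hcn.intervalIntegrable _ _),
    intervalIntegral.integral_comp_neg, neg_zero, add_comm,
    intervalIntegral.integral_add_adjacent_intervals (hc.intervalIntegrable _ _)
      (hc.intervalIntegrable _ _)]

open Set in
theorem hasDerivAt_cdf_absLaw (μ : Measure ℝ) [IsProbabilityMeasure μ]
    (hint : Integrable (charFun μ)) {t : ℝ} (ht : 0 < t) :
    HasDerivAt (fun t => cdf (absLaw μ) t) (fourierDensity μ t + fourierDensity μ (-t)) t := by
  refine (hasDerivAt_absPrimitive hint t).congr_of_eventuallyEq ?_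
  filter_upwards [lt_mem_nhds ht] with s hs using cdf_absLaw_of_nonneg μ hint (le_of_lt hs)

open Set in
theorem lawDensity_absLaw_ae_eq (μ : Measure ℝ) [IsProbabilityMeasure μ]
    (hint : Integrable (charFun μ)) :
    lawDensity (absLaw μ) =ᵐ[volume]
      (Ioi 0).indicator (fun x => fourierDensity μ x + fourierDensity μ (-x)) := by
  filter_upwards [Measure.ae_ne volume (0 : ℝ)] with x hx
  rcases lt_or_gt_of_ne hx with h | h
  · rw [indicator_of_notMem (by simpa using h.le), lawDensity]
    refine HasDerivAt.deriv ((hasDerivAt_const x (0 : ℝ)).congr_of_eventuallyEq ?_)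
    filter_upwards [gt_mem_nhds h] with s hs using cdf_absLaw_of_neg μ hs
  · rw [indicator_of_mem (by simpa using h)]
    exact (hasDerivAt_cdf_absLaw μ hint h).deriv

open Set in
theorem absLaw_eq_withDensity (μ : Measure ℝ) [IsProbabilityMeasure μ]
    (hint : Integrable (charFun μ)) :
    absLaw μ = volume.withDensity (fun z => ENNReal.ofReal (lawDensity (absLaw μ) z)) := by
  have hc := continuous_fourierDensity hint
  have hc2 : Continuous fun x => fourierDensity μ x + fourierDensity μ (-x) := by fun_prop
  have hae : (fun z => ENNReal.ofReal (lawDensity (absLaw μ) z)) =ᵐ[volume]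
      (Ioi 0).indicator
        (fun x => ENNReal.ofReal (fourierDensity μ x + fourierDensity μ (-x))) := by
    filter_upwards [lawDensity_absLaw_ae_eq μ hint] with x hx
    rw [hx]
    by_cases h : x ∈ Ioi (0 : ℝ) <;> simp [h]
  rw [withDensity_congr_ae hae]
  refine Measure.ext_of_Iic _ _ fun t => ?_
  rw [withDensity_apply _ measurableSet_Iic, setLIntegral_indicator measurableSet_Ioi,
    Ioi_inter_Iic, ← ofReal_cdf]
  rcases lt_or_ge t 0 with ht | ht
  · rw [cdf_absLaw_of_neg μ ht, Ioc_eq_empty (by simpa using ht.le)]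
    simp
  · have hi : IntegrableOn (fun x => fourierDensity μ x + fourierDensity μ (-x)) (Ioc 0 t) :=
      (hc2.continuousOn.integrableOn_compact isCompact_Icc).mono_set Ioc_subset_Icc_self
    rw [cdf_absLaw_of_nonneg μ hint ht, absPrimitive, intervalIntegral.integral_of_le ht,
      ofReal_integral_eq_lintegral_ofReal hi (ae_of_all _ fun x =>
        add_nonneg (fourierDensity_nonneg μ hint x) (fourierDensity_nonneg μ hint _))]

theorem continuous_cdf_absLaw (μ : Measure ℝ) [IsProbabilityMeasure μ]
    (hint : Integrable (charFun μ)) : Continuous (fun t => cdf (absLaw μ) t) := by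
  have hp : Continuous (absPrimitive μ) :=
    continuous_iff_continuousAt.2 fun t => (hasDerivAt_absPrimitive hint t).continuousAt
  have h : (fun t => cdf (absLaw μ) t) = fun t => absPrimitive μ (max t 0) := by
    ext t
    rcases lt_or_ge t 0 with ht | ht
    · rw [cdf_absLaw_of_neg μ ht, max_eq_right ht.le, absPrimitive, intervalIntegral.integral_same]
    · rw [max_eq_left ht, cdf_absLaw_of_nonneg μ hint ht]
  rw [h]
  fun_prop

/-- The inverse function theorem is applied to this smooth function rather than to the distribution
function of `|X|`, with which it agrees on `[0, ∞)`. -/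
theorem contDiff_absPrimitive {μ : Measure ℝ}
    (h : ContDiff ℝ ((⊤ : ℕ∞) : WithTop ℕ∞) (fourierDensity μ)) (hint : Integrable (charFun μ)) :
    ContDiff ℝ ((⊤ : ℕ∞) : WithTop ℕ∞) (absPrimitive μ) := by
  rw [contDiff_infty_iff_deriv]
  refine ⟨fun t => (hasDerivAt_absPrimitive hint t).differentiableAt, ?_⟩
  have : deriv (absPrimitive μ) = fun t => fourierDensity μ t + fourierDensity μ (-t) :=
    funext fun t => (hasDerivAt_absPrimitive hint t).deriv
  rw [this]
  exact h.add (h.comp contDiff_neg)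

/-- At an interior level the distribution function is a left inverse of the quantile function. -/
theorem cdf_lawQuantile (μ : Measure ℝ) [IsProbabilityMeasure μ]
    (hc : Continuous (fun t => cdf μ t)) {u : ℝ} (hu : u ∈ Set.Ioo (0 : ℝ) 1) :
    cdf μ (lawQuantile μ u) = u := by
  refine le_antisymm ?_ ((lawQuantile_le_iff μ hu _).1 le_rfl)
  refine le_of_tendsto (x := nhdsWithin (lawQuantile μ u) (Set.Iio (lawQuantile μ u)))
    ((hc.tendsto _).mono_left nhdsWithin_le_nhds) ?_
  filter_upwards [self_mem_nhdsWithin] with t ht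
  exact (not_le.1 fun h => (not_le.2 ht) ((lawQuantile_le_iff μ hu t).2 h)).le

theorem lawQuantile_pos_of_cdf_zero (μ : Measure ℝ) [IsProbabilityMeasure μ] (h0 : cdf μ 0 = 0)
    {u : ℝ} (hu : u ∈ Set.Ioo (0 : ℝ) 1) : 0 < lawQuantile μ u := by
  by_contra! h
  have := (lawQuantile_le_iff μ hu 0).1 h
  linarith [hu.1]

/-! ### Tail bound and scaling for stable laws. -/

namespace IsStableLaw

variable {α β F : ℝ} {μ : Measure ℝ}

theorem norm_one_sub_charFun_le (h : IsStableLaw α β F μ) (hF : 0 < F) (t : ℝ) :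
    ‖1 - charFun μ t‖ ≤ 2 * F * (1 + |β * Real.tan (Real.pi * α / 2)|) * |t| ^ α := by
  have := h.isProbabilityMeasure
  set T := Real.tan (Real.pi * α / 2)
  set z : ℂ := -((F * |t| ^ α : ℝ) : ℂ) * (1 - Complex.I * ((β * Real.sign t * T : ℝ) : ℂ)) with hz
  have hp : 0 ≤ F * |t| ^ α := by positivity
  have hzn : ‖z‖ ≤ F * |t| ^ α * (1 + |β * T|) := by
    rw [hz, norm_mul, norm_neg, Complex.norm_real, Real.norm_of_nonneg hp]
    refine mul_le_mul_of_nonneg_left ((norm_sub_le _ _).trans ?_) hp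
    rw [norm_one, norm_mul, Complex.norm_I, one_mul, Complex.norm_real, Real.norm_eq_abs]
    have hs : |Real.sign t| ≤ 1 := by
      rcases Real.sign_apply_eq t with h | h | h <;> rw [h] <;> norm_num
    have : |β * Real.sign t * T| ≤ |β * T| := by
      rw [mul_right_comm, abs_mul]
      exact mul_le_of_le_one_right (abs_nonneg _) hs
    linarith
  have hle : ‖1 - charFun μ t‖ ≤ 2 * ‖z‖ := by
    rcases le_or_gt ‖z‖ 1 with h1 | h1
    · rw [h.charFun_eq, norm_sub_rev]
      exact Complex.norm_exp_sub_one_le h1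
    · exact norm_one_sub_charFun_le_two.trans (by linarith)
  nlinarith

/-- The behavior `1 - φ(t) = O(|t|^α)` of the characteristic function, averaged over `|t| ≤ 2 / r`,
controls the mass beyond `r`. The exponent matches the power in the estimator, so the `α`-th power
of the quantile is `O(1 / (1 - u))`. -/
theorem exists_one_sub_cdf_absLaw_le (h : IsStableLaw α β F μ) (hF : 0 < F) (hα : 0 < α) :
    ∃ C, 0 ≤ C ∧ ∀ t, 0 < t → (1 - cdf (absLaw μ) t) * t ^ α ≤ C := by
  have := h.isProbabilityMeasure
  set A := 2 * F * (1 + |β * Real.tan (Real.pi * α / 2)|) with hA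
  have hA0 : 0 ≤ A := by positivity
  refine ⟨2 * A * 2 ^ α, by positivity, fun r hr => ?_⟩
  have hcompl : 1 - cdf (absLaw μ) r = μ.real {x | r < |x|} := by
    rw [cdf_absLaw, ← probReal_compl_eq_one_sub (measurableSet_le (by fun_prop) (by fun_prop))]
    congr 1
    ext x
    simp
  have hI : ‖∫ t in (-2 * r⁻¹)..(2 * r⁻¹), 1 - charFun μ t‖ ≤
      A * (2 * r⁻¹) ^ α * |2 * r⁻¹ - -2 * r⁻¹| := by
    refine intervalIntegral.norm_integral_le_of_norm_le_const fun t ht => ?_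
    refine (h.norm_one_sub_charFun_le hF t).trans ?_
    have hr' : 0 < r⁻¹ := inv_pos.2 hr
    rw [Set.uIoc_of_le (by nlinarith)] at ht
    have : |t| ≤ 2 * r⁻¹ := abs_le.2 ⟨by linarith [ht.1], ht.2⟩
    gcongr
  have hb := measureReal_abs_gt_le_integral_charFun (μ := μ) hr
  rw [hcompl]
  have habs : |2 * r⁻¹ - -2 * r⁻¹| = 4 * r⁻¹ := by
    rw [show 2 * r⁻¹ - -2 * r⁻¹ = 4 * r⁻¹ by ring, abs_of_pos (by positivity)]
  rw [habs, Real.mul_rpow zero_le_two (by positivity), Real.inv_rpow hr.le] at hI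
  have hrα : 0 < r ^ α := by positivity
  calc μ.real {x | r < |x|} * r ^ α
      ≤ (2⁻¹ * r * (A * (2 ^ α * (r ^ α)⁻¹) * (4 * r⁻¹))) * r ^ α := by
        refine mul_le_mul_of_nonneg_right (hb.trans ?_) hrα.le
        gcongr
    _ = 2 * A * 2 ^ α := by field_simp; ring

theorem eq_map_mul (hμ : IsStableLaw α β F μ) {ν : Measure ℝ} (hν : IsStableLaw α β 1 ν)
    (hα : 0 < α) (hF : 0 < F) : μ = ν.map (fun x => F ^ α⁻¹ * x) := by
  have := hμ.isProbabilityMeasure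
  have := hν.isProbabilityMeasure
  have := Measure.isProbabilityMeasure_map (μ := ν) (f := fun x => F ^ α⁻¹ * x) (by fun_prop)
  have hp : 0 < F ^ α⁻¹ := by positivity
  refine Measure.ext_of_charFun (funext fun t => ?_)
  have hsign : Real.sign (F ^ α⁻¹ * t) = Real.sign t := by
    rcases lt_trichotomy t 0 with ht | rfl | ht
    · rw [Real.sign_of_neg ht, Real.sign_of_neg (mul_neg_of_pos_of_neg hp ht)]
    · rw [mul_zero]
    · rw [Real.sign_of_pos ht, Real.sign_of_pos (mul_pos hp ht)]
  rw [charFun_map_mul, hμ.charFun_eq, hν.charFun_eq, hsign, abs_mul, abs_of_pos hp,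
    Real.mul_rpow hp.le (abs_nonneg t), Real.rpow_inv_rpow hF.le hα.ne', one_mul]

theorem lawQuantile_absLaw (hμ : IsStableLaw α β F μ) {ν : Measure ℝ}
    (hν : IsStableLaw α β 1 ν) (hα : 0 < α) (hF : 0 < F) {u : ℝ} (hu : u ∈ Set.Ioo (0 : ℝ) 1) :
    lawQuantile (absLaw μ) u = F ^ α⁻¹ * lawQuantile (absLaw ν) u := by
  have := hμ.isProbabilityMeasure
  have := hν.isProbabilityMeasure
  have hp : 0 < F ^ α⁻¹ := by positivity
  refine eq_of_forall_ge_iff fun t => ?_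
  have hcdf : cdf (absLaw μ) t = cdf (absLaw ν) (t / F ^ α⁻¹) := by
    rw [cdf_absLaw, cdf_absLaw, hμ.eq_map_mul hν hα hF, map_measureReal_apply (by fun_prop)
      (measurableSet_le (by fun_prop) (by fun_prop))]
    congr 1
    ext x
    simp only [Set.mem_preimage, Set.mem_ofPred_eq, abs_mul, abs_of_pos hp]
    rw [le_div_iff₀' hp]
  rw [lawQuantile_le_iff _ hu, hcdf, ← lawQuantile_le_iff _ hu, le_div_iff₀' hp]

end IsStableLaw

/-! ### Order statistics, binomial tails and beta laws. -/

open Filter Topology Set in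
theorem sampleQuantile_le_iff {q : ℝ} (hq0 : 0 < q) (hq1 : q ≤ 1) {k : ℕ} (hk : 0 < k)
    (y : Fin k → ℝ) (t : ℝ) :
    sampleQuantile q y ≤ t ↔ ⌈q * k⌉₊ ≤ (Finset.univ.filter fun j => y j ≤ t).card := by
  have hk' : (0 : ℝ) < k := Nat.cast_pos.2 hk
  rw [Nat.ceil_le]
  refine Monotone.csInf_le_iff_le
    (N := fun t => (((Finset.univ.filter fun j => y j ≤ t).card : ℕ) : ℝ)) ?_ ?_ ?_ ?_ t
  · intro s t hst
    refine Nat.cast_le.2 (Finset.card_le_card fun j hj => ?_)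
    rw [Finset.mem_filter] at hj ⊢
    exact ⟨hj.1, hj.2.trans hst⟩
  · intro t
    refine tendsto_const_nhds.congr' ?_
    have h : ∀ᶠ s in 𝓝 t, ∀ j, t < y j → s < y j :=
      eventually_all.2 fun j => by
        by_cases hj : t < y j
        · filter_upwards [gt_mem_nhds hj] with s hs _ using hs
        · exact Eventually.of_forall fun s h => absurd h hj
    filter_upwards [self_mem_nhdsWithin, mem_nhdsWithin_of_mem_nhds h] with s hs hs2
    congr 2
    ext j
    simp only [Finset.mem_filter, Finset.mem_univ, true_and]
    exact ⟨fun hj => hj.trans hs, fun hj => by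
      by_contra! hlt
      exact (hs2 j hlt).not_ge hj⟩
  · obtain ⟨M, hM⟩ := (finite_range y).bddAbove
    refine ⟨M, ?_⟩
    rw [Finset.filter_true_of_mem fun j _ => hM (mem_range_self j), Finset.card_univ,
      Fintype.card_fin]
    exact mul_le_of_le_one_left hk'.le hq1
  · obtain ⟨L, hL⟩ := (finite_range y).bddBelow
    refine ⟨L - 1, ?_⟩
    rw [Finset.filter_false_of_mem fun j _ => by
      have := hL (mem_range_self j)
      linarith]
    simpa using mul_pos hq0 hk'

theorem measurable_card_filter_le {k : ℕ} (t : ℝ) :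
    Measurable fun y : Fin k → ℝ => (Finset.univ.filter fun j => y j ≤ t).card := by
  simp only [Finset.card_filter]
  refine Finset.measurable_sum _ fun j _ => ?_
  exact Measurable.ite (measurableSet_le (measurable_pi_apply j) measurable_const)
    measurable_const measurable_const

theorem measurable_sampleQuantile {q : ℝ} (hq0 : 0 < q) (hq1 : q ≤ 1) {k : ℕ} (hk : 0 < k) :
    Measurable fun y : Fin k → ℝ => sampleQuantile q y := by
  refine measurable_of_Iic fun t => ?_
  have : (fun y : Fin k → ℝ => sampleQuantile q y) ⁻¹' Set.Iic t =
      (fun y : Fin k → ℝ => (Finset.univ.filter fun j => y j ≤ t).card) ⁻¹' Set.Ici ⌈q * k⌉₊ := by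
    ext y
    exact sampleQuantile_le_iff hq0 hq1 hk y t
  rw [this]
  exact measurable_card_filter_le t measurableSet_Ici

/-- The upper tail of the binomial distribution. -/
noncomputable def binomialTail (n m : ℕ) (p : ℝ) : ℝ :=
  ∑ i ∈ Finset.range (n + 1), (n.choose i : ℝ) * (if m ≤ i then p ^ i * (1 - p) ^ (n - i) else 0)

open Set in
theorem measureReal_card_filter_le_eq {Ω : Type*} [MeasurableSpace Ω] {P : Measure Ω}
    [IsProbabilityMeasure P] {k : ℕ} {Y : Fin k → Ω → ℝ} {ρ : Measure ℝ} [IsProbabilityMeasure ρ]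
    (hY : ∀ j, HasLaw (Y j) ρ P) (hind : iIndepFun Y P) (t : ℝ) (m : ℕ) :
    P.real {ω | m ≤ (Finset.univ.filter fun j => Y j ω ≤ t).card} =
      binomialTail k m (cdf ρ t) := by
  set p := cdf ρ t with hp
  -- Partition by the exact set of indices with `Y j ω ≤ t`; independence gives each piece a product
  -- probability depending only on its cardinality.
  let B : Finset (Fin k) → Set Ω := fun S => {ω | (Finset.univ.filter fun j => Y j ω ≤ t) = S}
  let E : Finset (Fin k) → Fin k → Set ℝ := fun S j => if j ∈ S then Iic t else Ioi t
  have hE : ∀ S j, MeasurableSet (E S j) := fun S j => by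
    simp only [E]; split_ifs
    exacts [measurableSet_Iic, measurableSet_Ioi]
  have hBE : ∀ S, B S = ⋂ j ∈ (Finset.univ : Finset (Fin k)), Y j ⁻¹' E S j := by
    intro S
    ext ω
    simp only [B, E, mem_ofPred_eq, Finset.ext_iff, Finset.mem_filter, Finset.mem_univ, true_and,
      mem_iInter, mem_preimage, forall_const]
    refine forall_congr' fun j => ?_
    split_ifs with h <;> simp [h]
  have hBmeas : ∀ S, NullMeasurableSet (B S) P := fun S => by
    rw [hBE]
    exact Finset.nullMeasurableSet_biInter _ fun j _ =>
      (hY j).aemeasurable.nullMeasurableSet_preimage (hE S j)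
  have hp1 : ρ.real (Ioi t) = 1 - p := by
    rw [hp, cdf_eq_real, ← probReal_compl_eq_one_sub measurableSet_Iic, compl_Iic]
  have hBval : ∀ S, P.real (B S) = p ^ S.card * (1 - p) ^ (k - S.card) := by
    intro S
    rw [hBE, measureReal_def, hind.measure_inter_preimage_eq_mul _ fun j _ => hE S j,
      ENNReal.toReal_prod]
    have : ∀ j, (P (Y j ⁻¹' E S j)).toReal = if j ∈ S then p else 1 - p := by
      intro j
      have h1 : P.real (Y j ⁻¹' E S j) = ρ.real (E S j) :=
        (hY j).measureReal_eq (p := fun x => x ∈ E S j) (hE S j)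
      rw [← measureReal_def, h1]
      simp only [E]
      split_ifs with h
      · rw [hp, cdf_eq_real]
      · rw [← hp1]
    simp only [this]
    rw [Finset.prod_ite, Finset.prod_const, Finset.prod_const, Finset.filter_mem_eq_inter,
      Finset.univ_inter, Finset.filter_not, Finset.filter_mem_eq_inter, Finset.univ_inter,
      Finset.card_sdiff_of_subset (Finset.subset_univ S), Finset.card_univ, Fintype.card_fin]
  have hunion : {ω | m ≤ (Finset.univ.filter fun j => Y j ω ≤ t).card} =
      ⋃ S ∈ (Finset.univ : Finset (Fin k)).powerset.filter fun S => m ≤ S.card, B S := by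
    ext ω
    simp [B]
  rw [hunion, measureReal_biUnion_finset₀]
  · rw [Finset.sum_filter]
    simp only [hBval]
    have := Finset.sum_powerset_apply_card (x := (Finset.univ : Finset (Fin k)))
      (fun i => if m ≤ i then p ^ i * (1 - p) ^ (k - i) else 0)
    rw [this, Finset.card_univ, Fintype.card_fin, binomialTail]
    simp only [nsmul_eq_mul]
  · intro S _ T _ hST
    refine Disjoint.aedisjoint (disjoint_left.2 fun ω h1 h2 => hST ?_)
    exact h1.symm.trans h2
  · exact fun S _ => hBmeas S

theorem binomialTail_eq_sum_bernstein (a b : ℕ) (p : ℝ) :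
    binomialTail (a + b + 1) (a + 1) p =
      (∑ j ∈ Finset.range (b + 1), bernsteinPolynomial ℝ (a + b + 1) (a + 1 + j)).eval p := by
  rw [binomialTail, show a + b + 1 + 1 = (a + 1) + (b + 1) by ring, Finset.sum_range_add,
    Polynomial.eval_finsetSum]
  have h0 : ∑ i ∈ Finset.range (a + 1), ((a + b + 1).choose i : ℝ) *
      (if a + 1 ≤ i then p ^ i * (1 - p) ^ (a + b + 1 - i) else 0) = 0 :=
    Finset.sum_eq_zero fun i hi => by
      rw [if_neg (not_le.2 (Finset.mem_range.1 hi)), mul_zero]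
  rw [h0, zero_add]
  refine Finset.sum_congr rfl fun j _ => ?_
  rw [if_pos (Nat.le_add_right _ _), bernsteinPolynomial]
  simp [mul_assoc]

/-- The normalization of the beta density with integer parameters `a + 1`, `b + 1`. -/
noncomputable def betaNorm (a b : ℕ) : ℝ := (a + b + 1) * (a + b).choose a

theorem betaNorm_pos (a b : ℕ) : 0 < betaNorm a b := by
  have : 0 < (a + b).choose a := Nat.choose_pos (Nat.le_add_right a b)
  rw [betaNorm]
  positivity

/-- The derivative of each Bernstein polynomial is a difference of consecutive lower-degree ones, so
the derivative of the tail telescopes to a single term, the beta density. -/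
theorem binomialTail_eq_integral (a b : ℕ) (p : ℝ) :
    binomialTail (a + b + 1) (a + 1) p = ∫ u in (0 : ℝ)..p, betaNorm a b * (u ^ a * (1 - u) ^ b) := by
  set T : Polynomial ℝ :=
    ∑ j ∈ Finset.range (b + 1), bernsteinPolynomial ℝ (a + b + 1) (a + 1 + j) with hT
  have hd : Polynomial.derivative T = ((a + b + 1 : ℕ) : Polynomial ℝ) *
      bernsteinPolynomial ℝ (a + b) a := by
    rw [hT, Polynomial.derivative_sum]
    have : ∀ j ∈ Finset.range (b + 1),
        Polynomial.derivative (bernsteinPolynomial ℝ (a + b + 1) (a + 1 + j)) =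
          ((a + b + 1 : ℕ) : Polynomial ℝ) * bernsteinPolynomial ℝ (a + b) (a + j) -
          ((a + b + 1 : ℕ) : Polynomial ℝ) * bernsteinPolynomial ℝ (a + b) (a + (j + 1)) := by
      intro j _
      rw [show a + 1 + j = a + j + 1 by ring, bernsteinPolynomial.derivative_succ, mul_sub]
      rfl
    rw [Finset.sum_congr rfl this, Finset.sum_range_sub',
      bernsteinPolynomial.eq_zero_of_lt ℝ (show a + b < a + (b + 1) by omega), mul_zero, sub_zero,
      add_zero]
  have hderiv : ∀ u : ℝ, HasDerivAt (fun u => T.eval u) (betaNorm a b * (u ^ a * (1 - u) ^ b)) u := by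
    intro u
    refine (T.hasDerivAt u).congr_deriv ?_
    rw [hd, bernsteinPolynomial, betaNorm]
    simp
    ring
  have h0 : T.eval 0 = 0 := by
    rw [hT, Polynomial.eval_finsetSum]
    refine Finset.sum_eq_zero fun j _ => ?_
    rw [bernsteinPolynomial.eval_at_0, if_neg (by omega)]
  rw [binomialTail_eq_sum_bernstein, ← hT,
    intervalIntegral.integral_eq_sub_of_hasDerivAt (fun u _ => hderiv u)
      (Continuous.intervalIntegrable (by fun_prop) _ _), h0, sub_zero]

/-- The beta law with integer parameters `a + 1`, `b + 1`. -/
noncomputable def betaLaw (a b : ℕ) : Measure ℝ :=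
  (volume.restrict (Set.Ioo 0 1)).withDensity
    fun u => ENNReal.ofReal (betaNorm a b * (u ^ a * (1 - u) ^ b))

open Set in
theorem betaLaw_Iic_inter_Ioo (a b : ℕ) {p : ℝ} (hp0 : 0 ≤ p) (hp1 : p ≤ 1) :
    betaLaw a b (Iic p ∩ Ioo 0 1) = ENNReal.ofReal (binomialTail (a + b + 1) (a + 1) p) := by
  have hm : MeasurableSet (Iic p ∩ Ioo (0 : ℝ) 1) := measurableSet_Iic.inter measurableSet_Ioo
  have hae : (Iic p ∩ Ioo (0 : ℝ) 1 : Set ℝ) =ᵐ[volume] Ioc 0 p := by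
    filter_upwards [Measure.ae_ne volume (1 : ℝ)] with x hx
    refine propext ⟨fun h => ⟨h.2.1, h.1⟩, fun h => ⟨h.2, h.1, lt_of_le_of_ne (h.2.trans hp1) hx⟩⟩
  have hc : Continuous fun u : ℝ => betaNorm a b * (u ^ a * (1 - u) ^ b) := by fun_prop
  rw [betaLaw, withDensity_apply _ hm, Measure.restrict_restrict hm, inter_assoc, inter_self,
    setLIntegral_congr hae, ← ofReal_integral_eq_lintegral_ofReal, binomialTail_eq_integral,
    intervalIntegral.integral_of_le hp0]
  · exact (hc.continuousOn.integrableOn_compact isCompact_Icc).mono_set Ioc_subset_Icc_self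
  · rw [Filter.EventuallyLE, ae_restrict_iff' measurableSet_Ioc]
    refine ae_of_all _ fun u hu => mul_nonneg (betaNorm_pos a b).le
      (mul_nonneg (pow_nonneg hu.1.le _) (pow_nonneg ?_ _))
    linarith [hu.2]

theorem betaLaw_compl_Ioo (a b : ℕ) : betaLaw a b (Set.Ioo 0 1)ᶜ = 0 := by
  refine (withDensity_absolutelyContinuous _ _) ?_
  rw [Measure.restrict_apply measurableSet_Ioo.compl, Set.compl_inter_self, measure_empty]

theorem ae_betaLaw_mem_Ioo (a b : ℕ) : ∀ᵐ u ∂betaLaw a b, u ∈ Set.Ioo (0 : ℝ) 1 :=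
  betaLaw_compl_Ioo a b

instance (a b : ℕ) : IsProbabilityMeasure (betaLaw a b) := by
  constructor
  have h := betaLaw_Iic_inter_Ioo a b zero_le_one le_rfl
  have h1 : binomialTail (a + b + 1) (a + 1) 1 = 1 := by
    rw [binomialTail, Finset.sum_eq_single (a + b + 1)]
    · simp
    · intro i hi hne
      have : a + b + 1 - i ≠ 0 := by
        have := Finset.mem_range.1 hi
        omega
      simp [this]
    · simp
  rw [h1, ENNReal.ofReal_one] at h
  have hset : (Set.Iic 1 ∩ Set.Ioo (0 : ℝ) 1) = Set.Ioo 0 1 :=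
    Set.inter_eq_right.2 fun x hx => hx.2.le
  rw [← h, hset]
  exact (measure_congr (Filter.eventuallyEq_univ.2 (ae_betaLaw_mem_Ioo a b))).symm

/-- Monotonicity is available only on `(0, 1)`, where the infimum is genuine; this suffices because
the beta law lives there. -/
theorem aemeasurable_lawQuantile (ρ : Measure ℝ) [IsProbabilityMeasure ρ] (a b : ℕ) :
    AEMeasurable (lawQuantile ρ) (betaLaw a b) := by
  refine AEMeasurable.mono_ac (ν := volume.restrict (Set.Ioo 0 1)) ?_
    (withDensity_absolutelyContinuous _ _)
  refine aemeasurable_restrict_of_monotoneOn measurableSet_Ioo fun u hu v hv huv => ?_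
  exact (lawQuantile_le_iff ρ hu _).2 (huv.trans ((lawQuantile_le_iff ρ hv _).1 le_rfl))

open Set in
theorem hasLaw_sampleQuantile {Ω : Type*} [MeasurableSpace Ω] {P : Measure Ω}
    [IsProbabilityMeasure P] {a b k : ℕ} {Y : Fin k → Ω → ℝ} {ρ : Measure ℝ}
    [IsProbabilityMeasure ρ] (hY : ∀ j, HasLaw (Y j) ρ P) (hind : iIndepFun Y P)
    {q : ℝ} (hq0 : 0 < q) (hq1 : q ≤ 1) (hk : k = a + b + 1) (hceil : ⌈q * k⌉₊ = a + 1) :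
    HasLaw (fun ω => sampleQuantile q (fun j => Y j ω)) ((betaLaw a b).map (lawQuantile ρ)) P := by
  have hk0 : 0 < k := by omega
  have hm : AEMeasurable (fun ω => sampleQuantile q (fun j => Y j ω)) P :=
    (measurable_sampleQuantile hq0 hq1 hk0).comp_aemeasurable
      (aemeasurable_pi_lambda _ fun j => (hY j).aemeasurable)
  have hG := aemeasurable_lawQuantile ρ a b
  refine ⟨hm, ?_⟩
  have := Measure.isProbabilityMeasure_map hm
  refine Measure.ext_of_Iic _ _ fun t => ?_
  rw [Measure.map_apply_of_aemeasurable hm measurableSet_Iic,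
    Measure.map_apply_of_aemeasurable hG measurableSet_Iic]
  have h1 : (fun ω => sampleQuantile q (fun j => Y j ω)) ⁻¹' Iic t =
      {ω | a + 1 ≤ (Finset.univ.filter fun j => Y j ω ≤ t).card} := by
    ext ω
    rw [← hceil]
    exact sampleQuantile_le_iff hq0 hq1 hk0 _ t
  have h2 : lawQuantile ρ ⁻¹' Iic t =ᵐ[betaLaw a b] (Iic (cdf ρ t) ∩ Ioo 0 1 : Set ℝ) := by
    filter_upwards [ae_betaLaw_mem_Ioo a b] with u hu
    exact propext ⟨fun h => ⟨(lawQuantile_le_iff ρ hu t).1 h, hu⟩,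
      fun h => (lawQuantile_le_iff ρ hu t).2 h.1⟩
  rw [h1, measure_congr h2, betaLaw_Iic_inter_Ioo a b (cdf_nonneg ρ t) (cdf_le_one ρ t),
    ← ofReal_measureReal, measureReal_card_filter_le_eq hY hind, hk]

/-! ### Moments of beta laws. -/

theorem betaNorm_mul_factorial (a b : ℕ) :
    betaNorm a b * (a.factorial * b.factorial) = (a + b + 1).factorial := by
  have h := Nat.add_choose_mul_factorial_mul_factorial a b
  rw [betaNorm, Nat.factorial_succ, ← h, Nat.choose_symm_add]
  push_cast
  ring

theorem betaNorm_succ_left (a b : ℕ) :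
    betaNorm (a + 1) b * (a + 1) = betaNorm a b * (a + b + 2) := by
  have h1 := betaNorm_mul_factorial a b
  have h2 := betaNorm_mul_factorial (a + 1) b
  rw [show a + 1 + b + 1 = (a + b + 1) + 1 by ring, Nat.factorial_succ (a + b + 1),
    Nat.factorial_succ a] at h2
  have ha : (0 : ℝ) < a.factorial := by positivity
  have hb : (0 : ℝ) < b.factorial := by positivity
  refine mul_right_cancel₀ (mul_pos ha hb).ne' ?_
  push_cast at h2
  linear_combination h2 - ((a : ℝ) + b + 2) * h1

theorem betaNorm_succ_right (a b : ℕ) :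
    betaNorm a (b + 1) * (b + 1) = betaNorm a b * (a + b + 2) := by
  have h1 := betaNorm_mul_factorial a b
  have h2 := betaNorm_mul_factorial a (b + 1)
  rw [show a + (b + 1) + 1 = (a + b + 1) + 1 by ring, Nat.factorial_succ (a + b + 1),
    Nat.factorial_succ b] at h2
  have ha : (0 : ℝ) < a.factorial := by positivity
  have hb : (0 : ℝ) < b.factorial := by positivity
  refine mul_right_cancel₀ (mul_pos ha hb).ne' ?_
  push_cast at h2
  linear_combination h2 - ((a : ℝ) + b + 2) * h1

theorem toReal_betaDensity (a b : ℕ) {u : ℝ} (hu : u ∈ Set.Ioo (0 : ℝ) 1) :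
    (ENNReal.ofReal (betaNorm a b * (u ^ a * (1 - u) ^ b))).toReal =
      betaNorm a b * (u ^ a * (1 - u) ^ b) :=
  ENNReal.toReal_ofReal (mul_nonneg (betaNorm_pos a b).le
    (mul_nonneg (pow_nonneg hu.1.le _) (pow_nonneg (sub_nonneg.2 hu.2.le) _)))

theorem integral_betaLaw (a b : ℕ) (g : ℝ → ℝ) :
    ∫ u, g u ∂betaLaw a b =
      ∫ u in Set.Ioo (0 : ℝ) 1, betaNorm a b * (u ^ a * (1 - u) ^ b) * g u := by
  rw [betaLaw, integral_withDensity_eq_integral_toReal_smul₀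
    (Measurable.aemeasurable (by fun_prop)) (ae_of_all _ fun _ => ENNReal.ofReal_lt_top)]
  refine setIntegral_congr_fun measurableSet_Ioo fun u hu => ?_
  simp only [toReal_betaDensity a b hu, smul_eq_mul]

theorem integrable_betaLaw_iff (a b : ℕ) (g : ℝ → ℝ) :
    Integrable g (betaLaw a b) ↔
      IntegrableOn (fun u => betaNorm a b * (u ^ a * (1 - u) ^ b) * g u) (Set.Ioo (0 : ℝ) 1) := by
  rw [betaLaw, integrable_withDensity_iff_integrable_smul₀'
    (Measurable.aemeasurable (by fun_prop)) (ae_of_all _ fun _ => ENNReal.ofReal_lt_top)]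
  refine integrableOn_congr_fun (fun u hu => ?_) measurableSet_Ioo
  simp only [toReal_betaDensity a b hu, smul_eq_mul]

theorem integrable_betaLaw_of_continuous (a b : ℕ) {g : ℝ → ℝ} (hg : Continuous g) :
    Integrable g (betaLaw a b) := by
  rw [integrable_betaLaw_iff]
  exact (Continuous.continuousOn (by fun_prop)).integrableOn_compact isCompact_Icc
    |>.mono_set Set.Ioo_subset_Icc_self

theorem integral_mul_betaLaw (a b : ℕ) (g : ℝ → ℝ) :
    ∫ u, u * g u ∂betaLaw a b = (a + 1) / (a + b + 2) * ∫ u, g u ∂betaLaw (a + 1) b := by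
  rw [integral_betaLaw, integral_betaLaw, ← integral_const_mul]
  refine integral_congr_ae (ae_of_all _ fun u => ?_)
  have h := betaNorm_succ_left a b
  have : (a : ℝ) + b + 2 ≠ 0 := by positivity
  simp only
  rw [pow_succ]
  field_simp
  linear_combination (-(u ^ a * u * (1 - u) ^ b * g u)) * h

theorem div_one_sub_betaDensity (a b : ℕ) (g : ℝ → ℝ) {u : ℝ} (hu : u ∈ Set.Ioo (0 : ℝ) 1) :
    betaNorm a (b + 1) * (u ^ a * (1 - u) ^ (b + 1)) * (g u / (1 - u)) =
      (a + b + 2) / (b + 1) * (betaNorm a b * (u ^ a * (1 - u) ^ b) * g u) := by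
  have h := betaNorm_succ_right a b
  have h1 : 1 - u ≠ 0 := (sub_pos.2 hu.2).ne'
  have : (b : ℝ) + 1 ≠ 0 := by positivity
  rw [pow_succ]
  field_simp
  linear_combination (u ^ a * g u) * h

/-- A weight `1 / (1 - u)` is absorbed by lowering the second parameter; the prefactor stays bounded
when `b` grows proportionally to `a + b`. -/
theorem integral_div_one_sub_betaLaw (a b : ℕ) (g : ℝ → ℝ) :
    ∫ u, g u / (1 - u) ∂betaLaw a (b + 1) =
      (a + b + 2) / (b + 1) * ∫ u, g u ∂betaLaw a b := by
  rw [integral_betaLaw, integral_betaLaw, ← integral_const_mul]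
  exact setIntegral_congr_fun measurableSet_Ioo fun u hu => div_one_sub_betaDensity a b g hu

theorem integrable_div_one_sub_betaLaw (a b : ℕ) {g : ℝ → ℝ} (hg : Integrable g (betaLaw a b)) :
    Integrable (fun u => g u / (1 - u)) (betaLaw a (b + 1)) := by
  rw [integrable_betaLaw_iff] at hg ⊢
  have h : IntegrableOn (fun u => (a + b + 2) / (b + 1) *
      (betaNorm a b * (u ^ a * (1 - u) ^ b) * g u)) (Set.Ioo (0 : ℝ) 1) := hg.const_mul _
  exact h.congr_fun
    (fun u hu => (div_one_sub_betaDensity a b g hu).symm) measurableSet_Ioo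

theorem integral_id_betaLaw (a b : ℕ) :
    ∫ u, u ∂betaLaw a b = (a + 1) / (a + b + 2) := by
  have := integral_mul_betaLaw a b fun _ => 1
  simpa using this

theorem integral_pow_succ_betaLaw (a b j : ℕ) :
    ∫ u, u ^ (j + 1) ∂betaLaw a b =
      (a + 1) / (a + b + 2) * ∫ u, u ^ j ∂betaLaw (a + 1) b := by
  rw [← integral_mul_betaLaw]
  simp only [pow_succ']

theorem integral_sub_betaLaw (a b : ℕ) (q : ℝ) :
    ∫ u, (u - q) ∂betaLaw a b = (a + 1) / (a + b + 2) - q := by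
  rw [integral_sub (f := fun u : ℝ => u) (integrable_betaLaw_of_continuous a b continuous_id) (integrable_const _),
    integral_id_betaLaw]
  simp

theorem integral_sub_pow_betaLaw (a b N : ℕ) (q : ℝ) :
    ∫ u, (u - q) ^ N ∂betaLaw a b = ∑ m ∈ Finset.range (N + 1),
      (∫ u, u ^ m ∂betaLaw a b) * ((-q) ^ (N - m) * N.choose m) := by
  simp only [sub_eq_add_neg, add_pow, mul_assoc]
  rw [integral_finsetSum _ fun m _ => integrable_betaLaw_of_continuous a b (by fun_prop)]
  simp only [integral_mul_const]

section centralMoments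

variable (a b : ℕ)

theorem integral_sq_betaLaw :
    ∫ u, u ^ 2 ∂betaLaw a b = (a + 1) * (a + 2) / ((a + b + 2) * (a + b + 3)) := by
  have h1 : (a : ℝ) + b + 2 ≠ 0 := by positivity
  have h2 : (a : ℝ) + b + 3 ≠ 0 := by positivity
  have h3 : (a : ℝ) + 1 + b + 2 ≠ 0 := by positivity
  rw [integral_pow_succ_betaLaw]
  simp only [pow_one]
  rw [integral_id_betaLaw]
  push_cast
  field_simp
  ring

theorem integral_cube_betaLaw :
    ∫ u, u ^ 3 ∂betaLaw a b =
      (a + 1) * (a + 2) * (a + 3) / ((a + b + 2) * (a + b + 3) * (a + b + 4)) := by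
  have h1 : (a : ℝ) + b + 2 ≠ 0 := by positivity
  have h2 : (a : ℝ) + b + 3 ≠ 0 := by positivity
  have h3 : (a : ℝ) + b + 4 ≠ 0 := by positivity
  rw [integral_pow_succ_betaLaw, integral_sq_betaLaw]
  push_cast
  rw [show (a : ℝ) + 1 + b + 2 = a + b + 3 by ring, show (a : ℝ) + 1 + b + 3 = a + b + 4 by ring]
  field_simp
  ring

theorem integral_fourth_betaLaw :
    ∫ u, u ^ 4 ∂betaLaw a b = (a + 1) * (a + 2) * (a + 3) * (a + 4) /
      ((a + b + 2) * (a + b + 3) * (a + b + 4) * (a + b + 5)) := by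
  have h1 : (a : ℝ) + b + 2 ≠ 0 := by positivity
  have h2 : (a : ℝ) + b + 3 ≠ 0 := by positivity
  have h3 : (a : ℝ) + b + 4 ≠ 0 := by positivity
  have h4 : (a : ℝ) + b + 5 ≠ 0 := by positivity
  rw [integral_pow_succ_betaLaw, integral_cube_betaLaw]
  push_cast
  rw [show (a : ℝ) + 1 + b + 2 = a + b + 3 by ring, show (a : ℝ) + 1 + b + 3 = a + b + 4 by ring,
    show (a : ℝ) + 1 + b + 4 = a + b + 5 by ring]
  field_simp
  ring

theorem integral_sub_sq_betaLaw (q : ℝ) {x n : ℝ} (hx : x = a + 1) (hn : n = a + b + 2) :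
    ∫ u, (u - q) ^ 2 ∂betaLaw a b = x / n * (1 - x / n) / (n + 1) + (x / n - q) ^ 2 := by
  rw [integral_sub_pow_betaLaw]
  simp only [Finset.sum_range_succ, Finset.sum_range_zero, integral_sq_betaLaw,
    pow_one, integral_id_betaLaw, pow_zero]
  have h1 : n ≠ 0 := by rw [hn]; positivity
  have h2 : n + 1 ≠ 0 := by rw [hn]; positivity
  rw [show (a : ℝ) + b + 3 = n + 1 by rw [hn]; ring, ← hn, show (a : ℝ) + 2 = x + 1 by rw [hx]; ring,
    ← hx]
  simp [Nat.choose_eq_descFactorial_div_factorial, Nat.descFactorial, Nat.factorial]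
  field_simp
  ring

theorem integral_sub_cube_betaLaw (q : ℝ) {x n : ℝ} (hx : x = a + 1) (hn : n = a + b + 2) :
    ∫ u, (u - q) ^ 3 ∂betaLaw a b =
      2 * (1 - 2 * (x / n)) * (x / n * (1 - x / n)) / ((n + 1) * (n + 2))
        + 3 * (x / n - q) * (x / n * (1 - x / n) / (n + 1)) + (x / n - q) ^ 3 := by
  rw [integral_sub_pow_betaLaw]
  simp only [Finset.sum_range_succ, Finset.sum_range_zero, integral_sq_betaLaw,
    integral_cube_betaLaw, pow_one, integral_id_betaLaw, pow_zero]
  have h1 : n ≠ 0 := by rw [hn]; positivity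
  have h2 : n + 1 ≠ 0 := by rw [hn]; positivity
  have h3 : n + 2 ≠ 0 := by rw [hn]; positivity
  rw [show (a : ℝ) + b + 3 = n + 1 by rw [hn]; ring, show (a : ℝ) + b + 4 = n + 2 by rw [hn]; ring,
    ← hn, show (a : ℝ) + 2 = x + 1 by rw [hx]; ring, show (a : ℝ) + 3 = x + 2 by rw [hx]; ring, ← hx]
  simp [Nat.choose_eq_descFactorial_div_factorial, Nat.descFactorial, Nat.factorial]
  field_simp
  ring

theorem integral_sub_fourth_betaLaw (q : ℝ) {x n : ℝ} (hx : x = a + 1) (hn : n = a + b + 2) :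
    ∫ u, (u - q) ^ 4 ∂betaLaw a b =
      3 * (x / n * (1 - x / n)) * (2 + x / n * (1 - x / n) * (n - 6)) /
          ((n + 1) * (n + 2) * (n + 3))
        + 4 * (x / n - q) *
          (2 * (1 - 2 * (x / n)) * (x / n * (1 - x / n)) / ((n + 1) * (n + 2)))
        + 6 * (x / n - q) ^ 2 * (x / n * (1 - x / n) / (n + 1)) + (x / n - q) ^ 4 := by
  rw [integral_sub_pow_betaLaw]
  simp only [Finset.sum_range_succ, Finset.sum_range_zero, integral_sq_betaLaw,
    integral_cube_betaLaw, integral_fourth_betaLaw, pow_one, integral_id_betaLaw, pow_zero]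
  have h1 : n ≠ 0 := by rw [hn]; positivity
  have h2 : n + 1 ≠ 0 := by rw [hn]; positivity
  have h3 : n + 2 ≠ 0 := by rw [hn]; positivity
  have h4 : n + 3 ≠ 0 := by rw [hn]; positivity
  rw [show (a : ℝ) + b + 3 = n + 1 by rw [hn]; ring, show (a : ℝ) + b + 4 = n + 2 by rw [hn]; ring,
    show (a : ℝ) + b + 5 = n + 3 by rw [hn]; ring,
    ← hn, show (a : ℝ) + 2 = x + 1 by rw [hx]; ring, show (a : ℝ) + 3 = x + 2 by rw [hx]; ring,
    show (a : ℝ) + 4 = x + 3 by rw [hx]; ring, ← hx]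
  simp [Nat.choose_eq_descFactorial_div_factorial, Nat.descFactorial, Nat.factorial]
  field_simp
  ring

end centralMoments

section momentBounds

variable {a b : ℕ} {q : ℝ} {n : ℝ}

theorem abs_mean_sub_le (hn : n = a + b + 2) (he : |a + 1 - q * n| ≤ 2) :
    |(a + 1) / n - q| ≤ 2 * n⁻¹ := by
  have hn0 : 0 < n := by rw [hn]; positivity
  rw [show ((a : ℝ) + 1) / n - q = (a + 1 - q * n) * n⁻¹ by field_simp, abs_mul,
    abs_of_pos (inv_pos.2 hn0)]
  exact mul_le_mul_of_nonneg_right he (inv_pos.2 hn0).le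

theorem mean_mem_Icc (hn : n = a + b + 2) : ((a : ℝ) + 1) / n ∈ Set.Icc (0 : ℝ) 1 := by
  have hn0 : 0 < n := by rw [hn]; positivity
  refine ⟨by positivity, (div_le_one hn0).2 ?_⟩
  rw [hn]
  linarith [b.cast_nonneg (α := ℝ)]

theorem abs_integral_sub_betaLaw_le (hn : n = a + b + 2) (he : |a + 1 - q * n| ≤ 2) :
    |∫ u, (u - q) ∂betaLaw a b| ≤ 2 * n⁻¹ := by
  rw [integral_sub_betaLaw, ← hn]
  exact abs_mean_sub_le hn he

theorem abs_integral_sub_sq_betaLaw_sub_le (hq0 : 0 ≤ q) (hq1 : q ≤ 1) (hn : n = a + b + 2)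
    (he : |a + 1 - q * n| ≤ 2) :
    |∫ u, (u - q) ^ 2 ∂betaLaw a b - (q - q ^ 2) * n⁻¹| ≤ 7 * n⁻¹ ^ 2 := by
  have hd := abs_mean_sub_le hn he
  obtain ⟨hp0, hp1⟩ := mean_mem_Icc (a := a) hn
  have hn0 : 0 < n := by rw [hn]; positivity
  rw [integral_sub_sq_betaLaw a b q rfl hn]
  set p := ((a : ℝ) + 1) / n
  set r := n⁻¹ with hr
  have hr0 : 0 < r := inv_pos.2 hn0
  have hs0 : 0 < (n + 1)⁻¹ := by positivity
  have hsr : (n + 1)⁻¹ ≤ r := inv_anti₀ hn0 (by linarith)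
  have hid : p * (1 - p) / (n + 1) + (p - q) ^ 2 - (q - q ^ 2) * r =
      (p - q) * (1 - p - q) * r - p * (1 - p) * (r * (n + 1)⁻¹) + (p - q) ^ 2 := by
    rw [hr]; field_simp; ring
  rw [hid]
  have h1 : |(p - q) * (1 - p - q) * r| ≤ 2 * r ^ 2 := by
    rw [abs_mul, abs_mul, abs_of_pos hr0]
    have : |1 - p - q| ≤ 1 := abs_le.2 ⟨by linarith, by linarith⟩
    have := mul_le_mul hd this (abs_nonneg _) (by positivity)
    nlinarith
  have h2 : |p * (1 - p) * (r * (n + 1)⁻¹)| ≤ r ^ 2 := by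
    have hv0 : 0 ≤ p * (1 - p) := mul_nonneg hp0 (by linarith)
    have hv1 : p * (1 - p) ≤ 1 := by nlinarith
    rw [abs_of_nonneg (by positivity)]
    calc p * (1 - p) * (r * (n + 1)⁻¹) ≤ 1 * (r * r) := by gcongr
      _ = r ^ 2 := by ring
  have h3 : |(p - q) ^ 2| ≤ 4 * r ^ 2 := by
    rw [abs_pow]
    calc |p - q| ^ 2 ≤ (2 * r) ^ 2 := by gcongr
      _ = 4 * r ^ 2 := by ring
  calc _ ≤ |(p - q) * (1 - p - q) * r| + |p * (1 - p) * (r * (n + 1)⁻¹)| + |(p - q) ^ 2| :=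
        (abs_add_le _ _).trans (add_le_add_left (abs_sub _ _) _)
    _ ≤ _ := by linarith

theorem third_central_moment_le {p : ℝ} (hp0 : 0 ≤ p) (hp1 : p ≤ 1) (hn0 : 0 < n) :
    |2 * (1 - 2 * p) * (p * (1 - p)) / ((n + 1) * (n + 2))| ≤ 2 * n⁻¹ ^ 2 := by
  have hv0 : 0 ≤ p * (1 - p) := mul_nonneg hp0 (by linarith)
  have hv1 : p * (1 - p) ≤ 1 := by nlinarith
  have h1 : |1 - 2 * p| ≤ 1 := abs_le.2 ⟨by linarith, by linarith⟩
  have h2 : |1 - 2 * p| * (p * (1 - p)) ≤ 1 * 1 := by gcongr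
  have h3 : n ^ 2 ≤ (n + 1) * (n + 2) := by nlinarith
  have h4 : 0 < (n + 1) * (n + 2) := by positivity
  rw [abs_div, abs_mul, abs_mul, abs_two, abs_of_nonneg hv0, abs_of_pos h4, inv_pow,
    ← div_eq_mul_inv]
  exact div_le_div₀ zero_le_two (by linarith) (by positivity) h3

/-- The skewness term carries `1 / ((n + 1)(n + 2))`, and the offset of the mean from `q` is itself
`O(1/n)`; both yield order `n⁻²`. -/
theorem abs_integral_sub_cube_betaLaw_le (hn : n = a + b + 2) (he : |a + 1 - q * n| ≤ 2) :
    |∫ u, (u - q) ^ 3 ∂betaLaw a b| ≤ 12 * n⁻¹ ^ 2 := by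
  have hd := abs_mean_sub_le hn he
  obtain ⟨hp0, hp1⟩ := mean_mem_Icc (a := a) hn
  have hn0 : 0 < n := by rw [hn]; positivity
  have hn2 : 2 ≤ n := by rw [hn]; linarith [a.cast_nonneg (α := ℝ), b.cast_nonneg (α := ℝ)]
  rw [integral_sub_cube_betaLaw a b q rfl hn]
  set p := ((a : ℝ) + 1) / n
  have h1 := third_central_moment_le hp0 hp1 hn0
  set r := n⁻¹ with hr
  have hr0 : 0 < r := inv_pos.2 hn0
  have hr1 : r ≤ 1 / 2 := by rw [hr, one_div]; exact inv_anti₀ two_pos hn2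
  have hv0 : 0 ≤ p * (1 - p) := mul_nonneg hp0 (by linarith)
  have hv1 : p * (1 - p) ≤ 1 := by nlinarith
  have hvr : p * (1 - p) / (n + 1) ≤ r := by
    rw [hr, ← one_div]
    gcongr
    linarith
  have h2 : |3 * (p - q) * (p * (1 - p) / (n + 1))| ≤ 6 * r ^ 2 := by
    rw [abs_mul, abs_mul, abs_of_nonneg (a := p * (1 - p) / (n + 1)) (by positivity),
      abs_of_pos (a := (3 : ℝ)) (by norm_num)]
    calc 3 * |p - q| * (p * (1 - p) / (n + 1)) ≤ 3 * (2 * r) * r := by gcongr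
      _ = 6 * r ^ 2 := by ring
  have h3 : |(p - q) ^ 3| ≤ 4 * r ^ 2 := by
    rw [abs_pow]
    calc |p - q| ^ 3 ≤ (2 * r) ^ 3 := by gcongr
      _ = 8 * r ^ 2 * r := by ring
      _ ≤ 8 * r ^ 2 * (1 / 2) := by gcongr
      _ = 4 * r ^ 2 := by ring
  refine (abs_add_three _ _ _).trans ?_
  linarith

theorem integral_sub_fourth_betaLaw_le (hn : n = a + b + 2) (he : |a + 1 - q * n| ≤ 2) :
    ∫ u, (u - q) ^ 4 ∂betaLaw a b ≤ 40 * n⁻¹ ^ 2 := by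
  have hd := abs_mean_sub_le hn he
  obtain ⟨hp0, hp1⟩ := mean_mem_Icc (a := a) hn
  have hn0 : 0 < n := by rw [hn]; positivity
  have hn2 : 2 ≤ n := by rw [hn]; linarith [a.cast_nonneg (α := ℝ), b.cast_nonneg (α := ℝ)]
  rw [integral_sub_fourth_betaLaw a b q rfl hn]
  set p := ((a : ℝ) + 1) / n
  have h1 := third_central_moment_le hp0 hp1 hn0
  set r := n⁻¹ with hr
  have hr0 : 0 < r := inv_pos.2 hn0
  have hr1 : r ≤ 1 / 2 := by rw [hr, one_div]; exact inv_anti₀ two_pos hn2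
  have hv0 : 0 ≤ p * (1 - p) := mul_nonneg hp0 (by linarith)
  have hv1 : p * (1 - p) ≤ 1 := by nlinarith
  have hvr : p * (1 - p) / (n + 1) ≤ r := by
    rw [hr, ← one_div]
    gcongr
    linarith
  have h0 : 3 * (p * (1 - p)) * (2 + p * (1 - p) * (n - 6)) / ((n + 1) * (n + 2) * (n + 3))
      ≤ 6 * r ^ 2 := by
    have hn' : 6 * r ^ 2 = 6 / n ^ 2 := by rw [hr]; field_simp
    rw [hn', div_le_div_iff₀ (by positivity) (by positivity)]
    have hb : 2 + p * (1 - p) * (n - 6) ≤ n + 2 := by nlinarith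
    have hb' : 3 * (p * (1 - p)) * (2 + p * (1 - p) * (n - 6)) ≤ 3 * (n + 2) := by
      nlinarith [mul_le_mul_of_nonneg_left hb hv0, mul_le_mul_of_nonneg_right hv1
        (by linarith : (0 : ℝ) ≤ n + 2)]
    calc _ ≤ 3 * (n + 2) * n ^ 2 := mul_le_mul_of_nonneg_right hb' (by positivity)
      _ ≤ 6 * ((n + 1) * (n + 2) * (n + 3)) := by nlinarith [pow_pos hn0 3, pow_pos hn0 2]
  have h2 : 6 * (p - q) ^ 2 * (p * (1 - p) / (n + 1)) ≤ 12 * r ^ 2 := by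
    rw [← sq_abs]
    calc 6 * |p - q| ^ 2 * (p * (1 - p) / (n + 1)) ≤ 6 * (2 * r) ^ 2 * r := by gcongr
      _ = 24 * r ^ 2 * r := by ring
      _ ≤ 24 * r ^ 2 * (1 / 2) := by gcongr
      _ = 12 * r ^ 2 := by ring
  have h3 : (p - q) ^ 4 ≤ 4 * r ^ 2 := by
    rw [← (show Even 4 by decide).pow_abs]
    calc |p - q| ^ 4 ≤ (2 * r) ^ 4 := by gcongr
      _ = 16 * r ^ 2 * r ^ 2 := by ring
      _ ≤ 16 * r ^ 2 * (1 / 2) ^ 2 := by gcongr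
      _ = 4 * r ^ 2 := by ring
  have h4 : 4 * (p - q) * (2 * (1 - 2 * p) * (p * (1 - p)) / ((n + 1) * (n + 2))) ≤ 8 * r ^ 2 := by
    refine (le_abs_self _).trans ?_
    rw [abs_mul, abs_mul, abs_of_pos (a := (4 : ℝ)) (by norm_num)]
    calc _ ≤ 4 * (2 * r) * (2 * r ^ 2) := by gcongr
      _ = 16 * r ^ 2 * r := by ring
      _ ≤ 16 * r ^ 2 * (1 / 2) := by gcongr
      _ = 8 * r ^ 2 := by ring
  linarith [sq_nonneg r]

end momentBounds

/-! ### Variance of a quadratic function plus a weighted cubic remainder. -/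

/-- Expand the second moment of `A D + S` with `S = B D^2 + R`, then subtract the squared mean. The
summands of the constant bound, in order, the error in `E D^2`, the third moment, the term `E (D
R)`, `E S^2`, and the squared mean. Only `O(ε)` is needed for `E R`, since the mean is squared. -/
theorem abs_variance_quadratic_add_le {Ω : Type*} [MeasurableSpace Ω] {P : Measure Ω}
    [IsProbabilityMeasure P] {D R : Ω → ℝ} (hD : AEStronglyMeasurable D P)
    (hD1 : ∀ᵐ ω ∂P, |D ω| ≤ 1) (hR : MemLp R 2 P) {ε v : ℝ} (A B c : ℝ)
    (h1 : |∫ ω, D ω ∂P| ≤ ε) (h2 : |∫ ω, D ω ^ 2 ∂P - v| ≤ ε ^ 2) (h2' : ∫ ω, D ω ^ 2 ∂P ≤ ε)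
    (h3 : |∫ ω, D ω ^ 3 ∂P| ≤ ε ^ 2) (h4 : ∫ ω, D ω ^ 4 ∂P ≤ ε ^ 2)
    (hDR : |∫ ω, D ω * R ω ∂P| ≤ ε ^ 2) (hR1 : |∫ ω, R ω ∂P| ≤ ε)
    (hR2 : ∫ ω, R ω ^ 2 ∂P ≤ ε ^ 2) :
    |variance (fun ω => c + (A * D ω + (B * D ω ^ 2 + R ω))) P - A ^ 2 * v| ≤
      (A ^ 2 + 2 * |A| * |B| + 2 * |A| + (2 * B ^ 2 + 2) + (|A| + |B| + 1) ^ 2) * ε ^ 2 := by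
  have hDp : ∀ j : ℕ, Integrable (fun ω => D ω ^ j) P := fun j =>
    Integrable.of_bound (C := 1) (hD.pow j) (by
      filter_upwards [hD1] with ω hω
      rw [norm_pow]
      exact pow_le_one₀ (norm_nonneg _) hω)
  have hε : 0 ≤ ε := (abs_nonneg _).trans h1
  have hDL : MemLp D 2 P := MemLp.of_bound hD 1 hD1
  have hD2L : MemLp (fun ω => D ω ^ 2) 2 P := MemLp.of_bound (hD.pow 2) 1 (by
    filter_upwards [hD1] with ω hω
    rw [norm_pow]
    exact pow_le_one₀ (norm_nonneg _) hω)
  have hSL : MemLp (fun ω => B * D ω ^ 2 + R ω) 2 P := (hD2L.const_mul B).add hR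
  have hYL : MemLp (fun ω => A * D ω + (B * D ω ^ 2 + R ω)) 2 P := (hDL.const_mul A).add hSL
  have hDi : Integrable D P := hDL.integrable one_le_two
  have hRi : Integrable R P := hR.integrable one_le_two
  have hSi : Integrable (fun ω => B * D ω ^ 2 + R ω) P := hSL.integrable one_le_two
  have hDRi : Integrable (fun ω => D ω * R ω) P := hDL.integrable_mul hR
  have hR2i : Integrable (fun ω => R ω ^ 2) P := hR.integrable_sq
  have hS2i : Integrable (fun ω => (B * D ω ^ 2 + R ω) ^ 2) P := hSL.integrable_sq
  have hES : ∫ ω, (B * D ω ^ 2 + R ω) ∂P = B * ∫ ω, D ω ^ 2 ∂P + ∫ ω, R ω ∂P := by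
    rw [integral_add ((hDp 2).const_mul B) hRi, integral_const_mul]
  have hEY : ∫ ω, (A * D ω + (B * D ω ^ 2 + R ω)) ∂P =
      A * ∫ ω, D ω ∂P + (B * ∫ ω, D ω ^ 2 ∂P + ∫ ω, R ω ∂P) := by
    rw [integral_add (hDi.const_mul A) hSi, integral_const_mul, hES]
  have hEY2 : ∫ ω, (A * D ω + (B * D ω ^ 2 + R ω)) ^ 2 ∂P =
      A ^ 2 * ∫ ω, D ω ^ 2 ∂P + 2 * A * B * ∫ ω, D ω ^ 3 ∂P + 2 * A * ∫ ω, D ω * R ω ∂P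
        + ∫ ω, (B * D ω ^ 2 + R ω) ^ 2 ∂P := by
    have i1 : Integrable (fun ω => A ^ 2 * D ω ^ 2) P := (hDp 2).const_mul _
    have i2 : Integrable (fun ω => 2 * A * B * D ω ^ 3) P := (hDp 3).const_mul _
    have i3 : Integrable (fun ω => 2 * A * (D ω * R ω)) P := hDRi.const_mul _
    have i12 : Integrable (fun ω => A ^ 2 * D ω ^ 2 + 2 * A * B * D ω ^ 3) P := i1.add i2
    have i123 : Integrable
        (fun ω => A ^ 2 * D ω ^ 2 + 2 * A * B * D ω ^ 3 + 2 * A * (D ω * R ω)) P := i12.add i3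
    rw [← integral_const_mul, ← integral_const_mul, ← integral_const_mul, ← integral_add i1 i2,
      ← integral_add i12 i3, ← integral_add i123 hS2i]
    congr with ω
    ring
  have hS2 : ∫ ω, (B * D ω ^ 2 + R ω) ^ 2 ∂P ≤ (2 * B ^ 2 + 2) * ε ^ 2 := by
    calc ∫ ω, (B * D ω ^ 2 + R ω) ^ 2 ∂P
        ≤ ∫ ω, (2 * B ^ 2 * D ω ^ 4 + 2 * R ω ^ 2) ∂P :=
          integral_mono hS2i (((hDp 4).const_mul _).add (hR2i.const_mul _)) fun ω => by
            simp only
            nlinarith [sq_nonneg (B * D ω ^ 2 - R ω)]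
      _ = 2 * B ^ 2 * ∫ ω, D ω ^ 4 ∂P + 2 * ∫ ω, R ω ^ 2 ∂P := by
          rw [integral_add ((hDp 4).const_mul _) (hR2i.const_mul _), integral_const_mul,
            integral_const_mul]
      _ ≤ 2 * B ^ 2 * ε ^ 2 + 2 * ε ^ 2 := by gcongr
      _ = _ := by ring
  have hS20 : 0 ≤ ∫ ω, (B * D ω ^ 2 + R ω) ^ 2 ∂P := integral_nonneg fun ω => sq_nonneg _
  have hD20 : 0 ≤ ∫ ω, D ω ^ 2 ∂P := integral_nonneg fun ω => sq_nonneg _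
  rw [variance_const_add hYL.aestronglyMeasurable, variance_eq_sub hYL]
  simp only [Pi.pow_apply]
  rw [hEY2, hEY]
  set d1 := ∫ ω, D ω ∂P
  set d2 := ∫ ω, D ω ^ 2 ∂P
  set d3 := ∫ ω, D ω ^ 3 ∂P
  set dr := ∫ ω, D ω * R ω ∂P
  set r1 := ∫ ω, R ω ∂P
  set s2 := ∫ ω, (B * D ω ^ 2 + R ω) ^ 2 ∂P
  have e1 : |A ^ 2 * (d2 - v)| ≤ A ^ 2 * ε ^ 2 := by
    rw [abs_mul, abs_of_nonneg (sq_nonneg A)]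
    gcongr
  have e2 : |2 * A * B * d3| ≤ 2 * |A| * |B| * ε ^ 2 := by
    rw [abs_mul, abs_mul, abs_mul, abs_two]
    gcongr
  have e3 : |2 * A * dr| ≤ 2 * |A| * ε ^ 2 := by
    rw [abs_mul, abs_mul, abs_two]
    gcongr
  have e4 : |A * d1 + (B * d2 + r1)| ≤ (|A| + |B| + 1) * ε := by
    calc |A * d1 + (B * d2 + r1)| ≤ |A * d1| + (|B * d2| + |r1|) :=
          (abs_add_le _ _).trans (add_le_add_right (abs_add_le _ _) _)
      _ ≤ |A| * ε + (|B| * ε + ε) := by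
          rw [abs_mul, abs_mul, abs_of_nonneg hD20]
          gcongr
      _ = _ := by ring
  have e5 : (A * d1 + (B * d2 + r1)) ^ 2 ≤ (|A| + |B| + 1) ^ 2 * ε ^ 2 := by
    rw [← sq_abs, ← mul_pow]
    gcongr
  have e6 : 0 ≤ (A * d1 + (B * d2 + r1)) ^ 2 := sq_nonneg _
  have e7 := abs_le.1 e1
  have e8 := abs_le.1 e2
  have e9 := abs_le.1 e3
  rw [abs_le]
  constructor <;> nlinarith

/-- Square integrability of the weight uses up two units of the second parameter, hence the shift `b
+ 2` here and below. -/
theorem memLp_inv_one_sub_betaLaw (a b : ℕ) :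
    MemLp (fun u => (1 - u)⁻¹) 2 (betaLaw a (b + 2)) := by
  rw [memLp_two_iff_integrable_sq (Measurable.aestronglyMeasurable (by fun_prop))]
  have h := integrable_div_one_sub_betaLaw a (b + 1)
    (integrable_div_one_sub_betaLaw a b (integrable_const (1 : ℝ)))
  refine h.congr (ae_of_all _ fun u => ?_)
  simp only [div_eq_mul_inv, one_mul, sq]

theorem abs_sub_le_one_of_mem_Ioo {q u : ℝ} (hq0 : 0 ≤ q) (hq1 : q ≤ 1)
    (hu : u ∈ Set.Ioo (0 : ℝ) 1) : |u - q| ≤ 1 :=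
  abs_le.2 ⟨by linarith [hu.1], by linarith [hu.2]⟩

section remainder

variable {a b : ℕ} {q C M k : ℝ} {R : ℝ → ℝ}

theorem memLp_remainder_betaLaw (hq0 : 0 ≤ q) (hq1 : q ≤ 1) (hC : 0 ≤ C)
    (hRm : AEStronglyMeasurable R (betaLaw a (b + 2)))
    (hR : ∀ u ∈ Set.Ioo (0 : ℝ) 1, |R u| ≤ C * (|u - q| ^ 3 / (1 - u))) :
    MemLp R 2 (betaLaw a (b + 2)) := by
  refine ((memLp_inv_one_sub_betaLaw a b).const_mul C).mono hRm ?_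
  filter_upwards [ae_betaLaw_mem_Ioo a (b + 2)] with u hu
  have h1 : 0 < 1 - u := sub_pos.2 hu.2
  rw [Real.norm_eq_abs, Real.norm_eq_abs, abs_mul, abs_of_nonneg hC, abs_of_pos (inv_pos.2 h1)]
  refine (hR u hu).trans (mul_le_mul_of_nonneg_left ?_ hC)
  rw [← one_div]
  gcongr
  exact pow_le_one₀ (abs_nonneg _) (abs_sub_le_one_of_mem_Ioo hq0 hq1 hu)

theorem abs_integral_remainder_le (hq0 : 0 ≤ q) (hq1 : q ≤ 1) (hC : 0 ≤ C)
    (hR : ∀ u ∈ Set.Ioo (0 : ℝ) 1, |R u| ≤ C * (|u - q| ^ 3 / (1 - u)))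
    (hM : ((a : ℝ) + b + 3) / (b + 2) ≤ M) :
    |∫ u, R u ∂betaLaw a (b + 2)| ≤ C * M * ∫ u, (u - q) ^ 2 ∂betaLaw a (b + 1) := by
  have hi := integrable_div_one_sub_betaLaw a (b + 1)
    (integrable_betaLaw_of_continuous a (b + 1) (g := fun u => (u - q) ^ 2) (by fun_prop))
  have h0 : 0 ≤ ∫ u, (u - q) ^ 2 ∂betaLaw a (b + 1) := integral_nonneg fun u => sq_nonneg _
  have h1 : |∫ u, R u ∂betaLaw a (b + 2)| ≤ ∫ u, C * ((u - q) ^ 2 / (1 - u)) ∂betaLaw a (b + 2) := by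
    rw [← Real.norm_eq_abs]
    refine norm_integral_le_of_norm_le (hi.const_mul C) ?_
    filter_upwards [ae_betaLaw_mem_Ioo a (b + 2)] with u hu
    have h1 : 0 < 1 - u := sub_pos.2 hu.2
    rw [Real.norm_eq_abs]
    refine (hR u hu).trans (mul_le_mul_of_nonneg_left ?_ hC)
    rw [← sq_abs (u - q)]
    refine div_le_div_of_nonneg_right ?_ h1.le
    exact pow_le_pow_of_le_one (abs_nonneg _) (abs_sub_le_one_of_mem_Ioo hq0 hq1 hu) (by norm_num)
  rw [integral_const_mul, integral_div_one_sub_betaLaw a (b + 1)] at h1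
  refine h1.trans ?_
  rw [mul_assoc]
  refine mul_le_mul_of_nonneg_left (mul_le_mul_of_nonneg_right (le_of_eq_of_le ?_ hM) h0) hC
  push_cast
  congr 1 <;> ring

theorem abs_integral_sub_mul_remainder_le (hC : 0 ≤ C)
    (hR : ∀ u ∈ Set.Ioo (0 : ℝ) 1, |R u| ≤ C * (|u - q| ^ 3 / (1 - u)))
    (hM : ((a : ℝ) + b + 3) / (b + 2) ≤ M) :
    |∫ u, (u - q) * R u ∂betaLaw a (b + 2)| ≤
      C * M * ∫ u, (u - q) ^ 4 ∂betaLaw a (b + 1) := by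
  have hi := integrable_div_one_sub_betaLaw a (b + 1)
    (integrable_betaLaw_of_continuous a (b + 1) (g := fun u => (u - q) ^ 4) (by fun_prop))
  have h0 : 0 ≤ ∫ u, (u - q) ^ 4 ∂betaLaw a (b + 1) :=
    integral_nonneg fun u => (show Even 4 by decide).pow_nonneg _
  have h1 : |∫ u, (u - q) * R u ∂betaLaw a (b + 2)| ≤
      ∫ u, C * ((u - q) ^ 4 / (1 - u)) ∂betaLaw a (b + 2) := by
    rw [← Real.norm_eq_abs]
    refine norm_integral_le_of_norm_le (hi.const_mul C) ?_
    filter_upwards [ae_betaLaw_mem_Ioo a (b + 2)] with u hu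
    rw [Real.norm_eq_abs, abs_mul, ← (show Even 4 by decide).pow_abs (u - q)]
    calc |u - q| * |R u| ≤ |u - q| * (C * (|u - q| ^ 3 / (1 - u))) :=
          mul_le_mul_of_nonneg_left (hR u hu) (abs_nonneg _)
      _ = C * (|u - q| ^ 4 / (1 - u)) := by ring
  rw [integral_const_mul, integral_div_one_sub_betaLaw a (b + 1)] at h1
  refine h1.trans ?_
  rw [mul_assoc]
  refine mul_le_mul_of_nonneg_left (mul_le_mul_of_nonneg_right (le_of_eq_of_le ?_ hM) h0) hC
  push_cast
  congr 1 <;> ring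

theorem integral_remainder_sq_le (hq0 : 0 ≤ q) (hq1 : q ≤ 1)
    (hR : ∀ u ∈ Set.Ioo (0 : ℝ) 1, |R u| ≤ C * (|u - q| ^ 3 / (1 - u)))
    (hRL : MemLp R 2 (betaLaw a (b + 2)))
    (hM : ((a : ℝ) + b + 3) / (b + 2) ≤ M) (hM' : ((a : ℝ) + b + 2) / (b + 1) ≤ M) :
    ∫ u, R u ^ 2 ∂betaLaw a (b + 2) ≤ C ^ 2 * M ^ 2 * ∫ u, (u - q) ^ 4 ∂betaLaw a b := by
  have hi := integrable_div_one_sub_betaLaw a (b + 1) (integrable_div_one_sub_betaLaw a b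
    (integrable_betaLaw_of_continuous a b (g := fun u => (u - q) ^ 4) (by fun_prop)))
  have h0 : 0 ≤ ∫ u, (u - q) ^ 4 ∂betaLaw a b :=
    integral_nonneg fun u => (show Even 4 by decide).pow_nonneg _
  have hr : 0 ≤ ((a : ℝ) + b + 2) / (b + 1) := by positivity
  have h1 : ∫ u, R u ^ 2 ∂betaLaw a (b + 2) ≤
      ∫ u, C ^ 2 * ((u - q) ^ 4 / (1 - u) / (1 - u)) ∂betaLaw a (b + 2) := by
    refine integral_mono_ae hRL.integrable_sq (hi.const_mul _) ?_
    filter_upwards [ae_betaLaw_mem_Ioo a (b + 2)] with u hu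
    have h1 : 0 < 1 - u := sub_pos.2 hu.2
    rw [← (show Even 4 by decide).pow_abs (u - q), ← sq_abs (R u)]
    calc |R u| ^ 2 ≤ (C * (|u - q| ^ 3 / (1 - u))) ^ 2 :=
          pow_le_pow_left₀ (abs_nonneg _) (hR u hu) 2
      _ = C ^ 2 * (|u - q| ^ 6 / (1 - u) / (1 - u)) := by field_simp
      _ ≤ C ^ 2 * (|u - q| ^ 4 / (1 - u) / (1 - u)) := by
          gcongr ?_ * (?_ / _ / _)
          exact pow_le_pow_of_le_one (abs_nonneg _) (abs_sub_le_one_of_mem_Ioo hq0 hq1 hu)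
            (by norm_num)
  rw [integral_const_mul, integral_div_one_sub_betaLaw a (b + 1),
    integral_div_one_sub_betaLaw a b] at h1
  refine h1.trans ?_
  have e : ((a : ℝ) + ((b + 1 : ℕ) : ℝ) + 2) / (((b + 1 : ℕ) : ℝ) + 1) ≤ M := by
    refine le_of_eq_of_le ?_ hM
    push_cast
    congr 1 <;> ring
  rw [mul_assoc, sq M, mul_assoc M M]
  refine mul_le_mul_of_nonneg_left ?_ (sq_nonneg C)
  exact mul_le_mul e (mul_le_mul_of_nonneg_right hM' h0) (mul_nonneg hr h0) (hr.trans hM')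

end remainder

theorem abs_variance_quadratic_add_betaLaw_sub_le {q : ℝ} (hq0 : 0 ≤ q) (hq1 : q ≤ 1) {R : ℝ → ℝ}
    {A B C M h₀ : ℝ} (hC : 0 ≤ C) (hM0 : 0 ≤ M) {a b : ℕ} {k : ℝ} (hk : k = a + b + 3)
    (hRm : AEStronglyMeasurable R (betaLaw a (b + 2)))
    (hh : ∀ u ∈ Set.Ioo (0 : ℝ) 1, |R u| ≤ C * (|u - q| ^ 3 / (1 - u)))
    (he : |a + 1 - q * k| ≤ 1) (hM : k / (b + 1) ≤ M) :
    |variance (fun u => h₀ + (A * (u - q) + (B * (u - q) ^ 2 + R u))) (betaLaw a (b + 2))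
        - A ^ 2 * ((q - q ^ 2) * k⁻¹)| ≤
      (A ^ 2 + 2 * |A| * |B| + 2 * |A| + (2 * B ^ 2 + 2) + (|A| + |B| + 1) ^ 2) *
        (20 * (1 + C * M) * k⁻¹) ^ 2 := by
  have hRL := memLp_remainder_betaLaw hq0 hq1 hC hRm hh
  have ha := a.cast_nonneg (α := ℝ)
  have hb := b.cast_nonneg (α := ℝ)
  have hk0 : 0 < k := by rw [hk]; positivity
  have hk3 : 3 ≤ k := by rw [hk]; linarith
  have hM1 : ((a : ℝ) + b + 3) / (b + 2) ≤ M := by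
    refine le_trans ?_ hM
    rw [hk]
    gcongr
    norm_num
  have hM2 : ((a : ℝ) + b + 2) / (b + 1) ≤ M := by
    refine le_trans ?_ hM
    rw [hk]
    gcongr
    norm_num
  have he' := abs_le.1 he
  -- Removing zero, one or two weights `1 / (1 - u)` leaves beta laws with `n = k + 1`, `k`, `k -
  -- 1`; the centering hypothesis is needed for all three.
  have he0 : |a + 1 - q * (k + 1)| ≤ 2 := abs_le.2 ⟨by linarith [he'.1], by linarith [he'.2]⟩
  have he1 : |a + 1 - q * k| ≤ 2 := he.trans one_le_two
  have he2 : |a + 1 - q * (k - 1)| ≤ 2 := abs_le.2 ⟨by linarith [he'.1], by linarith [he'.2]⟩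
  have hn0 : k + 1 = (a : ℝ) + ((b + 2 : ℕ) : ℝ) + 2 := by push_cast; linarith
  have hn1 : k = (a : ℝ) + ((b + 1 : ℕ) : ℝ) + 2 := by push_cast; linarith
  have hn2 : k - 1 = (a : ℝ) + (b : ℝ) + 2 := by linarith
  set r := k⁻¹ with hr
  have hr0 : 0 < r := inv_pos.2 hk0
  have hr1 : r ≤ 1 := inv_le_one_of_one_le₀ (by linarith)
  have hi0 : 0 < (k + 1)⁻¹ := by positivity
  have hi0r : (k + 1)⁻¹ ≤ r := inv_anti₀ hk0 (by linarith)
  have hi2 : 0 < (k - 1)⁻¹ := inv_pos.2 (by linarith)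
  have hi2r : (k - 1)⁻¹ ≤ 2 * r := by
    rw [hr, ← div_eq_mul_inv, inv_eq_one_div, div_le_div_iff₀ (by linarith) hk0]
    linarith
  have hi0sq : (k + 1)⁻¹ ^ 2 ≤ r ^ 2 := by gcongr
  have hi2sq : (k - 1)⁻¹ ^ 2 ≤ 4 * r ^ 2 := by
    calc (k - 1)⁻¹ ^ 2 ≤ (2 * r) ^ 2 := by gcongr
      _ = 4 * r ^ 2 := by ring
  have hCM : 0 ≤ C * M := mul_nonneg hC hM0
  have hv0 : 0 ≤ q - q ^ 2 := by nlinarith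
  have hv1 : q - q ^ 2 ≤ 1 := by nlinarith
  have hrr : r ^ 2 ≤ r := by
    rw [sq]
    exact mul_le_of_le_one_left hr0.le hr1
  have hvr : (q - q ^ 2) * r ≤ r := mul_le_of_le_one_left hr0.le hv1
  -- A deliberately generous choice: `ε` dominates the first-order bounds and `ε ^ 2` the
  -- second-order ones, including the remainder terms with factors `C * M` and `(C * M) ^ 2`.
  set ε := 20 * (1 + C * M) * r with hε
  have hεr : 20 * r ≤ ε := by rw [hε]; linarith [mul_nonneg hCM hr0.le]
  have hε2 : ε ^ 2 = 400 * r ^ 2 + 800 * (C * M) * r ^ 2 + 400 * (C * M) ^ 2 * r ^ 2 := by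
    rw [hε]; ring
  have hz1 : 0 ≤ (C * M) * r ^ 2 := by positivity
  have hz2 : 0 ≤ (C * M) ^ 2 * r ^ 2 := by positivity
  have m1 := abs_integral_sub_betaLaw_le hn0 he0
  have m2 := abs_integral_sub_sq_betaLaw_sub_le hq0 hq1 hn0 he0
  have m2' := abs_integral_sub_sq_betaLaw_sub_le hq0 hq1 hn1 he1
  have m3 := abs_integral_sub_cube_betaLaw_le hn0 he0
  have m4 := integral_sub_fourth_betaLaw_le hn0 he0
  have m4' := integral_sub_fourth_betaLaw_le hn1 he1
  have m4'' := integral_sub_fourth_betaLaw_le hn2 he2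
  rw [← hr] at m2' m4'
  have hdiff : |(q - q ^ 2) * (k + 1)⁻¹ - (q - q ^ 2) * r| ≤ r ^ 2 := by
    have : (q - q ^ 2) * (k + 1)⁻¹ - (q - q ^ 2) * r = -((q - q ^ 2) * ((k + 1)⁻¹ * r)) := by
      rw [hr]; field_simp; ring
    rw [this, abs_neg, abs_of_nonneg (by positivity)]
    calc (q - q ^ 2) * ((k + 1)⁻¹ * r) ≤ 1 * (r * r) := by gcongr
      _ = r ^ 2 := by ring
  have n2 : |∫ u, (u - q) ^ 2 ∂betaLaw a (b + 2) - (q - q ^ 2) * r| ≤ 8 * r ^ 2 := by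
    calc _ ≤ _ := abs_sub_le _ ((q - q ^ 2) * (k + 1)⁻¹) _
      _ ≤ 7 * (k + 1)⁻¹ ^ 2 + r ^ 2 := add_le_add m2 hdiff
      _ ≤ 8 * r ^ 2 := by linarith
  have n2' : ∫ u, (u - q) ^ 2 ∂betaLaw a (b + 2) ≤ 9 * r := by
    linarith [(abs_le.1 n2).2]
  have n2'' : ∫ u, (u - q) ^ 2 ∂betaLaw a (b + 1) ≤ 8 * r := by
    linarith [(abs_le.1 m2').2]
  have r1 := abs_integral_remainder_le hq0 hq1 hC hh hM1
  have r2 := abs_integral_sub_mul_remainder_le hC hh hM1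
  have r3 := integral_remainder_sq_le hq0 hq1 hh hRL hM1 hM2
  have c3 : 12 * (k + 1)⁻¹ ^ 2 ≤ ε ^ 2 := by linarith [sq_nonneg r]
  have c4 : 40 * (k + 1)⁻¹ ^ 2 ≤ ε ^ 2 := by linarith [sq_nonneg r]
  have c2 : 8 * r ^ 2 ≤ ε ^ 2 := by linarith [sq_nonneg r]
  have d1 : C * M * (40 * r ^ 2) ≤ ε ^ 2 := by linarith [sq_nonneg r]
  have d2 : C * M * (8 * r) ≤ ε := by
    have := mul_nonneg hCM hr0.le
    rw [hε]; linarith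
  have d3 : C ^ 2 * M ^ 2 * (40 * (k - 1)⁻¹ ^ 2) ≤ ε ^ 2 := by
    calc C ^ 2 * M ^ 2 * (40 * (k - 1)⁻¹ ^ 2) ≤ C ^ 2 * M ^ 2 * (40 * (4 * r ^ 2)) := by gcongr
      _ = 160 * ((C * M) ^ 2 * r ^ 2) := by ring
      _ ≤ ε ^ 2 := by linarith [sq_nonneg r]
  exact abs_variance_quadratic_add_le (P := betaLaw a (b + 2)) (D := fun u => u - q) (R := R)
    (ε := ε) (v := (q - q ^ 2) * r) (Continuous.aestronglyMeasurable (by fun_prop))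
    (by
      filter_upwards [ae_betaLaw_mem_Ioo a (b + 2)] with u hu
      exact abs_sub_le_one_of_mem_Ioo hq0 hq1 hu) hRL A B h₀
    (m1.trans (by linarith)) (n2.trans c2) (by linarith) (m3.trans c3) (m4.trans c4)
    (r2.trans ((mul_le_mul_of_nonneg_left m4' hCM).trans d1))
    (r1.trans ((mul_le_mul_of_nonneg_left n2'' hCM).trans d2))
    (r3.trans ((mul_le_mul_of_nonneg_left m4'' (by positivity)).trans d3))

theorem abs_variance_betaLaw_sub_le {q : ℝ} (hq0 : 0 ≤ q) (hq1 : q ≤ 1) {h : ℝ → ℝ}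
    {A B C M h₀ : ℝ} (hC : 0 ≤ C) (hM0 : 0 ≤ M) {a b : ℕ} {k : ℝ} (hk : k = a + b + 3)
    (hmeas : AEStronglyMeasurable h (betaLaw a (b + 2)))
    (hh : ∀ u ∈ Set.Ioo (0 : ℝ) 1,
      |h u - (h₀ + A * (u - q) + B * (u - q) ^ 2)| ≤ C * (|u - q| ^ 3 / (1 - u)))
    (he : |a + 1 - q * k| ≤ 1) (hM : k / (b + 1) ≤ M) :
    MemLp h 2 (betaLaw a (b + 2)) ∧
      |variance h (betaLaw a (b + 2)) - A ^ 2 * ((q - q ^ 2) * k⁻¹)| ≤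
        (A ^ 2 + 2 * |A| * |B| + 2 * |A| + (2 * B ^ 2 + 2) + (|A| + |B| + 1) ^ 2) *
          (20 * (1 + C * M) * k⁻¹) ^ 2 := by
  obtain ⟨R, hR⟩ : ∃ R : ℝ → ℝ, ∀ u, R u = h u - (h₀ + A * (u - q) + B * (u - q) ^ 2) :=
    ⟨_, fun _ => rfl⟩
  simp only [← hR] at hh
  have hRm : AEStronglyMeasurable R (betaLaw a (b + 2)) := by
    rw [funext hR]
    exact hmeas.sub (Continuous.aestronglyMeasurable (by fun_prop))
  have hfun : h = fun u => h₀ + (A * (u - q) + (B * (u - q) ^ 2 + R u)) := by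
    ext u
    rw [hR]
    ring
  refine ⟨?_, ?_⟩
  · have hpoly : MemLp (fun u => h₀ + A * (u - q) + B * (u - q) ^ 2) 2 (betaLaw a (b + 2)) := by
      rw [memLp_two_iff_integrable_sq (Continuous.aestronglyMeasurable (by fun_prop))]
      exact integrable_betaLaw_of_continuous _ _ (by fun_prop)
    refine (hpoly.add (memLp_remainder_betaLaw hq0 hq1 hC hRm hh)).ae_eq (ae_of_all _ fun u => ?_)
    simp only [Pi.add_apply, hR]
    ring
  · rw [hfun]
    exact abs_variance_quadratic_add_betaLaw_sub_le hq0 hq1 hC hM0 hk hRm hh he hM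

open Filter Topology in
theorem exists_variance_betaLaw_expansion {q : ℝ} (hq0 : 0 < q) (hq1 : q < 1) {h : ℝ → ℝ}
    {A B C h₀ : ℝ} (hC : 0 ≤ C) (hmeas : ∀ a b, AEStronglyMeasurable h (betaLaw a b))
    (hh : ∀ u ∈ Set.Ioo (0 : ℝ) 1,
      |h u - (h₀ + A * (u - q) + B * (u - q) ^ 2)| ≤ C * (|u - q| ^ 3 / (1 - u))) :
    ∃ (M : ℝ) (K : ℕ), ∀ k : ℕ, K ≤ k → ∃ a b : ℕ, k = a + b + 1 ∧ ⌈q * k⌉₊ = a + 1 ∧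
      MemLp h 2 (betaLaw a b) ∧
      |variance h (betaLaw a b) - A ^ 2 * ((q - q ^ 2) * (k : ℝ)⁻¹)| ≤ M / (k : ℝ) ^ 2 := by
  have h1q : 0 < 1 - q := sub_pos.2 hq1
  -- The threshold ensures `(1 - q) k ≥ 4`. Since `a < q k`, this leaves room for `k = a + b + 3`
  -- and gives `b + 1 ≥ (1 - q) k / 2`, hence the ratio bound `2 / (1 - q)`.
  refine ⟨(A ^ 2 + 2 * |A| * |B| + 2 * |A| + (2 * B ^ 2 + 2) + (|A| + |B| + 1) ^ 2) *
    (20 * (1 + C * (2 / (1 - q)))) ^ 2, ⌈4 / (1 - q)⌉₊ + 1, fun k hk => ?_⟩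
  have hkr : 4 / (1 - q) ≤ k := (Nat.le_ceil _).trans (by exact_mod_cast (Nat.le_succ _).trans hk)
  rw [div_le_iff₀ h1q] at hkr
  have hk0 : (0 : ℝ) < k := by
    have : 0 < k := by omega
    exact_mod_cast this
  have hm0 : 0 < ⌈q * k⌉₊ := Nat.ceil_pos.2 (by positivity)
  have hm1 := Nat.ceil_lt_add_one (a := q * (k : ℝ)) (by positivity)
  have hm2 := Nat.le_ceil (q * (k : ℝ))
  obtain ⟨a, ha⟩ : ∃ a, ⌈q * k⌉₊ = a + 1 := ⟨⌈q * k⌉₊ - 1, by omega⟩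
  have hlt : a + 1 + 2 < k + 1 := by
    have : ((a + 1 + 2 : ℕ) : ℝ) < ((k + 1 : ℕ) : ℝ) := by
      rw [ha] at hm1
      push_cast at hm1 ⊢
      nlinarith
    exact_mod_cast this
  obtain ⟨b, hb⟩ : ∃ b, k = a + b + 3 := ⟨k - (a + 3), by omega⟩
  have hkb : (k : ℝ) = a + b + 3 := by rw [hb]; push_cast; ring
  rw [ha] at hm1 hm2
  push_cast at hm1 hm2
  have hM : (k : ℝ) / (b + 1) ≤ 2 / (1 - q) := by
    rw [div_le_div_iff₀ (by positivity) h1q]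
    nlinarith
  obtain ⟨hL, hV⟩ := abs_variance_betaLaw_sub_le hq0.le hq1.le hC (M := 2 / (1 - q))
    (by positivity) hkb (hmeas a (b + 2)) hh (abs_le.2 ⟨by linarith, by linarith⟩) hM
  refine ⟨a, b + 2, by omega, ha, hL, hV.trans (le_of_eq ?_)⟩
  field_simp

/-! ### Local inversion and Taylor bounds. -/

open Filter Topology in
theorem ContDiffAt.exists_localInverse_real {f : ℝ → ℝ} {x d : ℝ} (hf : ContDiffAt ℝ 3 f x)
    (hd : HasDerivAt f d x) (hd0 : d ≠ 0) :
    ∃ g : ℝ → ℝ, ContDiffAt ℝ 3 g (f x) ∧ g (f x) = x ∧ HasDerivAt g d⁻¹ (f x) ∧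
      ∀ᶠ y in 𝓝 (f x), f (g y) = y := by
  have hfd := hd.hasFDerivAt_equiv hd0
  have h3 : (3 : WithTop ℕ∞) ≠ 0 := by norm_num
  have hinv : ∀ᶠ y in 𝓝 (f x), f (hf.localInverse hfd h3 y) = y :=
    (hf.hasStrictFDerivAt' hfd h3).eventually_right_inverse
  have hg := hf.to_localInverse hfd h3
  have hgx := hf.localInverse_apply_image hfd h3
  refine ⟨_, hg, hgx, ?_, hinv⟩
  exact HasDerivAt.of_local_left_inverse hg.continuousAt (by rwa [hgx]) hd0 hinv

open Filter Topology in
theorem ContDiffAt.exists_taylor_two_bound {f : ℝ → ℝ} {x d : ℝ} (hf : ContDiffAt ℝ 3 f x)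
    (hd : HasDerivAt f d x) :
    ∃ B C δ : ℝ, 0 ≤ C ∧ 0 < δ ∧ ∀ y, |y - x| < δ →
      |f y - (f x + d * (y - x) + B * (y - x) ^ 2)| ≤ C * |y - x| ^ 3 := by
  obtain ⟨U, hU, hfU⟩ := hf.contDiffOn le_rfl (by simp)
  obtain ⟨r, hr, hrU⟩ := Metric.mem_nhds_iff.1 (by simpa using hU)
  set s := Metric.ball x r with hs
  have hxs : x ∈ s := Metric.mem_ball_self hr
  have hsn : s ∈ 𝓝 x := Metric.ball_mem_nhds x hr
  have ht := taylor_isLittleO (n := 3) (convex_ball x r) hxs (hfU.mono hrU)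
  rw [← hs, nhdsWithin_eq_nhds.2 hsn] at ht
  have hd1 : iteratedDerivWithin 1 f s x = d := by
    rw [iteratedDerivWithin_one, derivWithin_of_mem_nhds hsn, hd.deriv]
  have hpoly : ∀ y, taylorWithinEval f 3 s x y = f x + d * (y - x) +
      (iteratedDerivWithin 2 f s x / 2) * (y - x) ^ 2 +
      (iteratedDerivWithin 3 f s x / 6) * (y - x) ^ 3 := by
    intro y
    simp only [taylorWithinEval_succ, taylor_within_zero_eval, hd1, smul_eq_mul]
    norm_num [Nat.factorial, hd1]
    ring
  -- Expanding to order three with a little-o error, then moving the cubic term into the error,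
  -- gives the cubic bound for the quadratic polynomial.
  obtain ⟨δ, hδ, hball⟩ := Metric.eventually_nhds_iff.1 (ht.def one_pos)
  refine ⟨iteratedDerivWithin 2 f s x / 2, 1 + |iteratedDerivWithin 3 f s x / 6|, δ, by positivity,
    hδ, fun y hy => ?_⟩
  have h1 := hball (y := y) (by rwa [Real.dist_eq])
  rw [hpoly, Real.norm_eq_abs, Real.norm_eq_abs, one_mul, abs_pow] at h1
  set c := iteratedDerivWithin 3 f s x / 6
  set B := iteratedDerivWithin 2 f s x / 2
  calc |f y - (f x + d * (y - x) + B * (y - x) ^ 2)|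
      = |(f y - (f x + d * (y - x) + B * (y - x) ^ 2 + c * (y - x) ^ 3)) + c * (y - x) ^ 3| := by
        congr 1; ring
    _ ≤ |y - x| ^ 3 + |c * (y - x) ^ 3| := (abs_add_le _ _).trans (add_le_add_left h1 _)
    _ = (1 + |c|) * |y - x| ^ 3 := by rw [abs_mul, abs_pow]; ring

/-- A local third-order bound and a growth bound at `1` give a weighted third-order bound on
`(0, 1)`. -/
theorem exists_weighted_taylor_bound {h : ℝ → ℝ} {q d B C δ E : ℝ} (hq : q ∈ Set.Ioo (0 : ℝ) 1)
    (hC : 0 ≤ C) (hδ : 0 < δ)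
    (hloc : ∀ u, |u - q| < δ → |h u - (h q + d * (u - q) + B * (u - q) ^ 2)| ≤ C * |u - q| ^ 3)
    (hE : 0 ≤ E) (hgrow : ∀ u ∈ Set.Ioo (0 : ℝ) 1, |h u| * (1 - u) ≤ E) :
    ∃ C', 0 ≤ C' ∧ ∀ u ∈ Set.Ioo (0 : ℝ) 1,
      |h u - (h q + d * (u - q) + B * (u - q) ^ 2)| ≤ C' * (|u - q| ^ 3 / (1 - u)) := by
  set E' := E + (|h q| + |d| + |B|) with hE'
  have hE'0 : 0 ≤ E' := by positivity
  refine ⟨C + E' / δ ^ 3, by positivity, fun u hu => ?_⟩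
  have h1 : 0 < 1 - u := sub_pos.2 hu.2
  have h1' : 1 - u ≤ 1 := by linarith [hu.1]
  have habs := abs_sub_le_one_of_mem_Ioo hq.1.le hq.2.le hu
  rw [← mul_div_assoc, le_div_iff₀ h1]
  rcases lt_or_ge |u - q| δ with hlt | hge
  · calc _ ≤ C * |u - q| ^ 3 * 1 := by
          gcongr
          exact hloc u hlt
      _ ≤ (C + E' / δ ^ 3) * |u - q| ^ 3 := by
          rw [mul_one]
          gcongr
          linarith [show 0 ≤ E' / δ ^ 3 by positivity]
  -- Away from `q` smallness is not needed: after multiplication by `1 - u` both `h` and the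
  -- polynomial are bounded, while `|u - q| ^ 3 / δ ^ 3 ≥ 1`.
  · have hpoly : |h q + d * (u - q) + B * (u - q) ^ 2| ≤ |h q| + |d| + |B| := by
      refine (abs_add_three _ _ _).trans ?_
      rw [abs_mul, abs_mul, abs_pow]
      have h2 : |u - q| ^ 2 ≤ 1 := pow_le_one₀ (abs_nonneg _) habs
      have h3 := mul_le_mul_of_nonneg_left habs (abs_nonneg d)
      have h4 := mul_le_mul_of_nonneg_left h2 (abs_nonneg B)
      linarith
    have h5 : |h u - (h q + d * (u - q) + B * (u - q) ^ 2)| * (1 - u) ≤ E' := by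
      calc _ ≤ (|h u| + |h q + d * (u - q) + B * (u - q) ^ 2|) * (1 - u) :=
            mul_le_mul_of_nonneg_right (abs_sub _ _) h1.le
        _ = |h u| * (1 - u) + |h q + d * (u - q) + B * (u - q) ^ 2| * (1 - u) := by ring
        _ ≤ E + (|h q| + |d| + |B|) * 1 := by
            gcongr
            exact hgrow u hu
        _ = E' := by rw [mul_one]
    have h6 : 1 ≤ |u - q| ^ 3 / δ ^ 3 := by
      rw [one_le_div (by positivity)]
      gcongr
    calc _ ≤ E' := h5
      _ ≤ E' * (|u - q| ^ 3 / δ ^ 3) := le_mul_of_one_le_right hE'0 h6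
      _ = E' / δ ^ 3 * |u - q| ^ 3 := by ring
      _ ≤ (C + E' / δ ^ 3) * |u - q| ^ 3 := by
          gcongr
          linarith

/-! ### Transfer to the estimator and conclusion. -/

theorem hasLaw_abs {Ω : Type*} [MeasurableSpace Ω] {P : Measure Ω} {X : Ω → ℝ} {μ : Measure ℝ}
    (hX : HasLaw X μ P) : HasLaw (fun ω => |X ω|) (absLaw μ) P where
  aemeasurable := hX.aemeasurable.abs
  map_eq := by
    rw [absLaw, ← hX.map_eq, AEMeasurable.map_map_of_aemeasurable (by fun_prop) hX.aemeasurable]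
    rfl

theorem measurable_div_rpow (W α : ℝ) : Measurable fun x : ℝ => (x / W) ^ α := by fun_prop

theorem aestronglyMeasurable_lawQuantile_div_rpow (ρ : Measure ℝ) [IsProbabilityMeasure ρ]
    (W α : ℝ) (a b : ℕ) :
    AEStronglyMeasurable (fun u => (lawQuantile ρ u / W) ^ α) (betaLaw a b) :=
  ((measurable_div_rpow W α).comp_aemeasurable
    (aemeasurable_lawQuantile ρ a b)).aestronglyMeasurable

theorem quantileEstimator_memLp_and_variance {Ω : Type*} [MeasurableSpace Ω] {P : Measure Ω}
    [IsProbabilityMeasure P] {a b k : ℕ} {X : Fin k → Ω → ℝ} {μ : Measure ℝ}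
    [IsProbabilityMeasure μ] (hX : ∀ j, HasLaw (X j) μ P) (hind : iIndepFun X P) (α W : ℝ)
    {q : ℝ} (hq0 : 0 < q) (hq1 : q ≤ 1) (hk : k = a + b + 1) (hceil : ⌈q * k⌉₊ = a + 1)
    (hL : MemLp (fun u => (lawQuantile (absLaw μ) u / W) ^ α) 2 (betaLaw a b)) :
    MemLp (fun ω => quantileEstimator α q W (fun j => X j ω)) 2 P ∧
      variance (fun ω => quantileEstimator α q W (fun j => X j ω)) P =
        variance (fun u => (lawQuantile (absLaw μ) u / W) ^ α) (betaLaw a b) := by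
  have hQ := hasLaw_sampleQuantile (Y := fun j ω => |X j ω|) (fun j => hasLaw_abs (hX j))
    (hind.comp (fun _ x => |x|) fun _ => by fun_prop) hq0 hq1 hk hceil
  have hG := aemeasurable_lawQuantile (absLaw μ) a b
  have hg := measurable_div_rpow W α
  constructor
  · have h1 := (memLp_map_measure_iff hg.aestronglyMeasurable hG).2 hL
    rw [← hQ.map_eq, memLp_map_measure_iff hg.aestronglyMeasurable hQ.aemeasurable] at h1
    exact h1
  · have h1 := variance_map (Y := lawQuantile (absLaw μ)) (hg.aemeasurable) hG
    rw [← hQ.map_eq, variance_map hg.aemeasurable hQ.aemeasurable] at h1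
    exact h1

namespace IsStableLaw

variable {α β F : ℝ} {μ ν : Measure ℝ}

theorem cdf_absLaw_zero (h : IsStableLaw α β F μ) (hα : 0 < α) (hF : 0 < F) :
    cdf (absLaw μ) 0 = 0 := by
  have := h.isProbabilityMeasure
  rw [cdf_absLaw_of_nonneg μ (h.integrable_charFun hα hF) le_rfl, absPrimitive,
    intervalIntegral.integral_same]

theorem lawQuantile_absLaw_pos (h : IsStableLaw α β F μ) (hα : 0 < α) (hF : 0 < F) {u : ℝ}
    (hu : u ∈ Set.Ioo (0 : ℝ) 1) : 0 < lawQuantile (absLaw μ) u := by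
  have := h.isProbabilityMeasure
  exact lawQuantile_pos_of_cdf_zero _ (h.cdf_absLaw_zero hα hF) hu

theorem absPrimitive_lawQuantile (h : IsStableLaw α β F μ) (hα : 0 < α) (hF : 0 < F) {u : ℝ}
    (hu : u ∈ Set.Ioo (0 : ℝ) 1) : absPrimitive μ (lawQuantile (absLaw μ) u) = u := by
  have := h.isProbabilityMeasure
  have hint := h.integrable_charFun hα hF
  rw [← cdf_absLaw_of_nonneg μ hint (h.lawQuantile_absLaw_pos hα hF hu).le]
  exact cdf_lawQuantile _ (continuous_cdf_absLaw μ hint) hu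

theorem strictMonoOn_absPrimitive (h : IsStableLaw α β F μ) (hα : 0 < α) (hα1 : α ≠ 1)
    (hF : 0 < F) : StrictMonoOn (absPrimitive μ) (Set.Ici 0) := by
  have hd := hasDerivAt_absPrimitive (h.integrable_charFun hα hF)
  refine strictMonoOn_of_deriv_pos (convex_Ici 0)
    (fun t _ => (hd t).continuousAt.continuousWithinAt) fun t ht => ?_
  rw [interior_Ici] at ht
  rw [(hd t).deriv]
  exact h.fourierDensity_add_neg_pos hα hα1 hF ht

open Filter Topology in
theorem contDiffAt_lawQuantile_absLaw (h : IsStableLaw α β F μ) (hα : 0 < α) (hα1 : α ≠ 1)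
    (hF : 0 < F) {q : ℝ} (hq : q ∈ Set.Ioo (0 : ℝ) 1) :
    ContDiffAt ℝ 3 (lawQuantile (absLaw μ)) q ∧
      HasDerivAt (lawQuantile (absLaw μ))
        (lawDensity (absLaw μ) (lawQuantile (absLaw μ) q))⁻¹ q := by
  have := h.isProbabilityMeasure
  have hint := h.integrable_charFun hα hF
  have hW := h.lawQuantile_absLaw_pos hα hF hq
  set W := lawQuantile (absLaw μ) q with hWdef
  have hΦ : ContDiffAt ℝ 3 (absPrimitive μ) W :=
    (contDiff_infty.1 (contDiff_absPrimitive (h.contDiff_fourierDensity hα hF) hint) 3).contDiffAt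
  have hdens : lawDensity (absLaw μ) W = fourierDensity μ W + fourierDensity μ (-W) :=
    (hasDerivAt_cdf_absLaw μ hint hW).deriv
  have hΦW : absPrimitive μ W = q := h.absPrimitive_lawQuantile hα hF hq
  obtain ⟨g, hg, hgW, hgd, hinv⟩ := hΦ.exists_localInverse_real (hasDerivAt_absPrimitive hint W)
    (h.fourierDensity_add_neg_pos hα hα1 hF hW).ne'
  rw [hΦW] at hg hgW hgd hinv
  -- The quantile function and the smooth local inverse take positive values with the same image
  -- under `absPrimitive μ`, which is injective on `[0, ∞)`.
  have heq : lawQuantile (absLaw μ) =ᶠ[𝓝 q] g := by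
    have hpos : ∀ᶠ y in 𝓝 q, 0 < g y :=
      hg.continuousAt.eventually (lt_mem_nhds (by rwa [hgW]))
    filter_upwards [hinv, hpos, Ioo_mem_nhds hq.1 hq.2] with y hy hgy hyI
    refine (h.strictMonoOn_absPrimitive hα hα1 hF).injOn
      (h.lawQuantile_absLaw_pos hα hF hyI).le hgy.le ?_
    rw [h.absPrimitive_lawQuantile hα hF hyI, hy]
  rw [hdens]
  exact ⟨hg.congr_of_eventuallyEq heq, hgd.congr_of_eventuallyEq heq⟩

-- Scaling factors `F` out of the `α`-th power, and at `u = q` the remaining base equals 1, so the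
-- chain rule leaves `F α / (f_Z(W) W)`, whose square is the constant in the variance.
open Filter Topology in
theorem contDiffAt_lawQuantile_div_rpow (hμ : IsStableLaw α β F μ) (hν : IsStableLaw α β 1 ν)
    (hα : 0 < α) (hα1 : α ≠ 1) (hF : 0 < F) {q : ℝ} (hq : q ∈ Set.Ioo (0 : ℝ) 1) :
    ContDiffAt ℝ 3 (fun u => (lawQuantile (absLaw μ) u / lawQuantile (absLaw ν) q) ^ α) q ∧
      HasDerivAt (fun u => (lawQuantile (absLaw μ) u / lawQuantile (absLaw ν) q) ^ α)
        (F * α / (lawDensity (absLaw ν) (lawQuantile (absLaw ν) q) * lawQuantile (absLaw ν) q))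
        q := by
  have hW := hν.lawQuantile_absLaw_pos hα one_pos hq
  obtain ⟨hc, hd⟩ := hν.contDiffAt_lawQuantile_absLaw hα hα1 one_pos hq
  set G := lawQuantile (absLaw ν) with hG
  have hne : G q / G q ≠ 0 := by rw [div_self hW.ne']; exact one_ne_zero
  have heq : (fun u => (lawQuantile (absLaw μ) u / G q) ^ α) =ᶠ[𝓝 q]
      fun u => F * (G u / G q) ^ α := by
    filter_upwards [Ioo_mem_nhds hq.1 hq.2] with u hu
    have hGu := hν.lawQuantile_absLaw_pos hα one_pos hu
    rw [hμ.lawQuantile_absLaw hν hα hF hu, mul_div_assoc, Real.mul_rpow (by positivity)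
      (div_pos hGu hW).le, Real.rpow_inv_rpow hF.le hα.ne']
  constructor
  · exact (contDiffAt_const.mul ((hc.div_const _).rpow_const_of_ne hne)).congr_of_eventuallyEq heq
  · refine HasDerivAt.congr_of_eventuallyEq ?_ heq
    have := ((hd.div_const (G q)).rpow_const (p := α) (Or.inl hne)).const_mul F
    refine this.congr_deriv ?_
    rw [div_self hW.ne', Real.one_rpow, mul_one]
    ring

theorem exists_abs_lawQuantile_div_rpow_mul_le (h : IsStableLaw α β F μ) (hα : 0 < α)
    (hF : 0 < F) {W : ℝ} (hW : 0 < W) :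
    ∃ E, 0 ≤ E ∧ ∀ u ∈ Set.Ioo (0 : ℝ) 1,
      |(lawQuantile (absLaw μ) u / W) ^ α| * (1 - u) ≤ E := by
  have := h.isProbabilityMeasure
  obtain ⟨C, hC, hbound⟩ := h.exists_one_sub_cdf_absLaw_le hF hα
  refine ⟨C / W ^ α, by positivity, fun u hu => ?_⟩
  have hG := h.lawQuantile_absLaw_pos hα hF hu
  have h1 := hbound _ hG
  rw [cdf_lawQuantile _ (continuous_cdf_absLaw μ (h.integrable_charFun hα hF)) hu] at h1
  rw [abs_of_nonneg (by positivity), Real.div_rpow hG.le hW.le, div_mul_eq_mul_div, mul_comm]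
  gcongr

end IsStableLaw

theorem lemma1 (α q F : ℝ) (hα0 : 0 < α) (hα2 : α ≤ 2) (hα1 : α ≠ 1)
    (hq0 : 0 < q) (hq1 : q < 1) (hF : 0 < F)
    (ν μ : Measure ℝ) (hν : IsStableLaw α 1 1 ν) (hμ : IsStableLaw α 1 F μ) :
    -- `Z = |S(α,1,1)|` has density `f_Z`, which is a genuine positive derivative of the
    -- distribution function at `W_q`, and `W_q` is positive
    absLaw ν = volume.withDensity (fun z => ENNReal.ofReal (lawDensity (absLaw ν) z)) ∧
    DifferentiableAt ℝ (fun t => cdf (absLaw ν) t) (lawQuantile (absLaw ν) q) ∧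
    0 < lawDensity (absLaw ν) (lawQuantile (absLaw ν) q) ∧
    0 < lawQuantile (absLaw ν) q ∧
    -- the variance is finite for large `k`, with the stated expansion
    ∃ (C : ℝ) (K : ℕ), ∀ k : ℕ, K ≤ k →
      ∀ (Ω : Type*) [MeasurableSpace Ω] (P : Measure Ω) [IsProbabilityMeasure P]
        (X : Fin k → Ω → ℝ), (∀ j, HasLaw (X j) μ P) → iIndepFun X P →
        MemLp (fun ω => quantileEstimator α q (lawQuantile (absLaw ν) q) (fun j => X j ω)) 2 P ∧
        |variance
            (fun ω => quantileEstimator α q (lawQuantile (absLaw ν) q) (fun j => X j ω)) P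
          - 1 / (k : ℝ) * ((q - q ^ 2) * α ^ 2 * F ^ 2 /
              (lawDensity (absLaw ν) (lawQuantile (absLaw ν) q) ^ 2 *
                lawQuantile (absLaw ν) q ^ 2))|
          ≤ C / (k : ℝ) ^ 2 := by
  have hνp := hν.isProbabilityMeasure
  have hμp := hμ.isProbabilityMeasure
  have hint := hν.integrable_charFun hα0 one_pos
  have hq : q ∈ Set.Ioo (0 : ℝ) 1 := ⟨hq0, hq1⟩
  have hW := hν.lawQuantile_absLaw_pos hα0 one_pos hq
  have hder := hasDerivAt_cdf_absLaw ν hint hW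
  have hdens : 0 < lawDensity (absLaw ν) (lawQuantile (absLaw ν) q) := by
    rw [lawDensity, hder.deriv]
    exact hν.fourierDensity_add_neg_pos hα0 hα1 one_pos hW
  refine ⟨absLaw_eq_withDensity ν hint, hder.differentiableAt, hdens, hW, ?_⟩
  obtain ⟨hc, hd⟩ := hμ.contDiffAt_lawQuantile_div_rpow hν hα0 hα1 hF hq
  obtain ⟨B, C, δ, hC, hδ, hloc⟩ := hc.exists_taylor_two_bound hd
  obtain ⟨E, hE, hgrow⟩ := hμ.exists_abs_lawQuantile_div_rpow_mul_le hα0 hF hW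
  obtain ⟨C', hC', hbound⟩ := exists_weighted_taylor_bound hq hC hδ hloc hE hgrow
  obtain ⟨M, K, hK⟩ := exists_variance_betaLaw_expansion hq0 hq1 hC'
    (aestronglyMeasurable_lawQuantile_div_rpow (absLaw μ) _ α) hbound
  refine ⟨M, K, fun k hk Ω _ P _ X hX hind => ?_⟩
  obtain ⟨a, b, hkab, hceil, hL, hV⟩ := hK k hk
  obtain ⟨h1, h2⟩ := quantileEstimator_memLp_and_variance hX hind α _ hq0 hq1.le hkab hceil hL
  refine ⟨h1, ?_⟩
  rw [h2]
  convert hV using 3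
  field_simp
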